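/- Let $G$ be a (discrete) group and $I$ a non-empty set. The Brandt semigroup $S=M^{0}(G,I)$ is the set $\{(g)_{i,j}: g\in G,\ i,j\in I\}\cup\{0\}$ with $(g)_{i,j}(h)_{k,l}=(gh)_{i,l}$ if $j=k$, and all other products equal to $0$. Let $\ell^{1}(S)$ be the complex Banach algebra of absolutely summable functions on $S$ with convolution, $f*g=\sum_{s,t\in S}f(s)g(t)\,\delta_{st}$. Then the following are equivalent: (i) $\ell^{1}(S)$ is strong pseudo-amenable; (ii) $G$ is amenable (that is, $\ell^{\infty}(G)$ has a left-invariant mean) and $I$ is finite; (iii) $\ell^{1}(S)$ is approximately amenable. Here, for a Banach algebra $A$, let $A\otimes_{p}A$ be the projective tensor product with the actions $a\cdot(b\otimes c)=ab\otimes c$, $(b\otimes c)\cdot a=b\otimes ca$, and let $\pi_{A}:A\otimes_{p}A\to A$, $\pi_{A}(a\otimes b)=ab$; the dual $X^{*}$ of a Banach $A$-bimodule $X$ is a bimodule by $(a\cdot f)(x)=f(x\cdot a)$, $(f\cdot a)(x)=f(a\cdot x)$. $A$ is *strong pseudo-amenable* if there is a (not necessarily bounded) net $(m_{\alpha})$ in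 $(A\otimes_{p}A)^{**}$ such that, in norm, for every $a\in A$, $$a\cdot m_{\alpha}-m_{\alpha}\cdot a\to 0,\qquad a\cdot\pi_{A}^{**}(m_{\alpha})=\pi_{A}^{**}(m_{\alpha})\cdot a\to a .$$ $A$ is *approximately amenable* if for every Banach $A$-bimodule $X$ and every bounded derivation $D:A\to X^{*}$ there is a net $(x_{\alpha})$ in $X^{*}$ with $D(a)=\lim_{\alpha}(a\cdot x_{\alpha}-x_{\alpha}\cdot a)$ in norm for every $a\in A$. -/

import Mathlib

open Filter Topology UniformSpace
open scoped TensorProduct ENNReal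

noncomputable section

universe u v

/-! ### The semigroup algebra `ℓ¹(S)` -/

/-- The Banach space `ℓ¹(S)` of absolutely summable complex functions on `S`. -/
abbrev SemigroupAlgebraL1 (S : Type u) : Type u := lp (fun _ : S => ℂ) 1

namespace SemigroupAlgebraL1

open scoped Classical in
/-- The point mass at `s` multiplied by the scalar `c`. -/
def delta {S : Type u} (s : S) (c : ℂ) : SemigroupAlgebraL1 S := lp.single 1 s c

theorem norm_delta {S : Type u} (s : S) (c : ℂ) : ‖delta s c‖ = ‖c‖ := by
  classical
  exact lp.norm_single (E := fun _ : S => ℂ) one_pos s c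

theorem delta_add {S : Type u} (s : S) (c d : ℂ) : delta s (c + d) = delta s c + delta s d := by
  classical
  exact lp.single_add (E := fun _ : S => ℂ) 1 s c d

theorem delta_smul {S : Type u} (s : S) (c d : ℂ) : delta s (c * d) = c • delta s d := by
  classical
  exact lp.single_smul (E := fun _ : S => ℂ) 1 s c d

theorem delta_zero {S : Type u} (s : S) : delta s 0 = 0 := by
  classical
  exact lp.single_zero (E := fun _ : S => ℂ) 1 s

theorem summable_norm {S : Type u} (f : SemigroupAlgebraL1 S) : Summable fun s => ‖f s‖ := by
  simpa using (lp.hasSum_norm (p := 1) (by simp) f).summable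

theorem norm_eq {S : Type u} (f : SemigroupAlgebraL1 S) : ‖f‖ = ∑' s, ‖f s‖ := by
  simpa using (lp.hasSum_norm (p := 1) (by simp) f).tsum_eq.symm

theorem ext_delta {S : Type u} {F : Type*} [AddCommMonoid F] [Module ℂ F] [TopologicalSpace F] [T2Space F]
    {φ ψ : SemigroupAlgebraL1 S →L[ℂ] F} (h : ∀ s c, φ (delta s c) = ψ (delta s c)) :
    φ = ψ := by
  classical
  refine lp.ext_continuousLinearMap (by simp) fun s => ?_
  ext
  simpa [delta] using h s 1

variable {S : Type u} [Semigroup S]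

/-- Convolution, `f * g = ∑_{s, t} f(s) g(t) δ_{st}`, a norm-convergent sum in `ℓ¹(S)`. -/
def conv (f g : SemigroupAlgebraL1 S) : SemigroupAlgebraL1 S :=
  ∑' p : S × S, delta (p.1 * p.2) (f p.1 * g p.2)

theorem summable_norm_conv (f g : SemigroupAlgebraL1 S) :
    Summable fun p : S × S => ‖delta (p.1 * p.2) (f p.1 * g p.2)‖ := by
  simp only [norm_delta, norm_mul]
  exact (summable_norm f).mul_of_nonneg (summable_norm g) (fun _ => norm_nonneg _)
    (fun _ => norm_nonneg _)

theorem summable_conv (f g : SemigroupAlgebraL1 S) :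
    Summable fun p : S × S => delta (p.1 * p.2) (f p.1 * g p.2) :=
  (summable_norm_conv f g).of_norm

open scoped Classical in
theorem conv_apply (f g : SemigroupAlgebraL1 S) (s : S) :
    conv f g s = ∑' p : S × S, if p.1 * p.2 = s then f p.1 * g p.2 else 0 := by
  have h := (lp.evalCLM ℂ (fun _ : S => ℂ) 1 s).map_tsum (summable_conv f g)
  refine Eq.trans h (tsum_congr fun p => ?_)
  change (lp.single 1 (p.1 * p.2) (f p.1 * g p.2) : SemigroupAlgebraL1 S) s = _
  rw [lp.single_apply, Pi.single_apply]
  simp only [eq_comm]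

theorem conv_add (f g h : SemigroupAlgebraL1 S) : conv f (g + h) = conv f g + conv f h := by
  simp only [conv]
  rw [← (summable_conv f g).tsum_add (summable_conv f h)]
  refine tsum_congr fun p => ?_
  rw [← delta_add, lp.coeFn_add, Pi.add_apply, mul_add]

theorem add_conv (f g h : SemigroupAlgebraL1 S) : conv (f + g) h = conv f h + conv g h := by
  simp only [conv]
  rw [← (summable_conv f h).tsum_add (summable_conv g h)]
  refine tsum_congr fun p => ?_
  rw [← delta_add, lp.coeFn_add, Pi.add_apply, add_mul]

theorem conv_smul (c : ℂ) (f g : SemigroupAlgebraL1 S) : conv f (c • g) = c • conv f g := by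
  simp only [conv]
  rw [← (summable_conv f g).tsum_const_smul c]
  refine tsum_congr fun p => ?_
  rw [← delta_smul, lp.coeFn_smul, Pi.smul_apply, smul_eq_mul, mul_left_comm]

theorem smul_conv (c : ℂ) (f g : SemigroupAlgebraL1 S) : conv (c • f) g = c • conv f g := by
  simp only [conv]
  rw [← (summable_conv f g).tsum_const_smul c]
  refine tsum_congr fun p => ?_
  rw [← delta_smul, lp.coeFn_smul, Pi.smul_apply, smul_eq_mul, mul_assoc]

theorem norm_conv_le (f g : SemigroupAlgebraL1 S) : ‖conv f g‖ ≤ ‖f‖ * ‖g‖ := by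
  refine (norm_tsum_le_tsum_norm (summable_norm_conv f g)).trans (le_of_eq ?_)
  rw [norm_eq f, norm_eq g, (summable_norm f).tsum_mul_tsum (summable_norm g)
    ((summable_norm f).mul_of_nonneg (summable_norm g) (fun _ => norm_nonneg _)
    (fun _ => norm_nonneg _))]
  simp only [norm_delta, norm_mul]

theorem conv_delta (s t : S) (c d : ℂ) :
    conv (delta s c) (delta t d) = delta (s * t) (c * d) := by
  classical
  have h : ∀ p : S × S, p ≠ (s, t) →
      delta (p.1 * p.2) ((delta s c) p.1 * (delta t d) p.2) = 0 := by
    rintro ⟨a, b⟩ hp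
    have : (delta s c) a * (delta t d) b = 0 := by
      by_cases ha : a = s
      · have hb : b ≠ t := fun hb => hp (by rw [ha, hb])
        have : (delta t d) b = 0 := lp.single_apply_ne (E := fun _ : S => ℂ) 1 t d hb
        rw [this, mul_zero]
      · have : (delta s c) a = 0 := lp.single_apply_ne (E := fun _ : S => ℂ) 1 s c ha
        rw [this, zero_mul]
    simp only [this, delta_zero]
  rw [conv, tsum_eq_single (s, t) h]
  have h1 : (delta s c) s = c := lp.single_apply_self (E := fun _ : S => ℂ) 1 s c
  have h2 : (delta t d) t = d := lp.single_apply_self (E := fun _ : S => ℂ) 1 t d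
  simp only [h1, h2]

/-- Convolution as a bounded bilinear map. -/
def convL : SemigroupAlgebraL1 S →L[ℂ] SemigroupAlgebraL1 S →L[ℂ] SemigroupAlgebraL1 S :=
  LinearMap.mkContinuous₂ (LinearMap.mk₂ ℂ conv add_conv smul_conv conv_add conv_smul) 1
    (fun f g => by simpa using norm_conv_le f g)

theorem convL_apply (f g : SemigroupAlgebraL1 S) : convL f g = conv f g := rfl

theorem conv_assoc (f g h : SemigroupAlgebraL1 S) :
    conv (conv f g) h = conv f (conv g h) := by
  have h3 : ∀ (s t : S) (c d : ℂ), convL (conv (delta s c) (delta t d)) =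
      (convL (delta s c)).comp (convL (delta t d)) := fun s t c d => ext_delta fun r e => by
    simp [convL_apply, conv_delta, mul_assoc]
  have h2 : ∀ (s : S) (c : ℂ), (convL.flip h).comp (convL (delta s c)) =
      (convL (delta s c)).comp (convL.flip h) := fun s c => ext_delta fun t d => by
    have := congrArg (fun φ => φ h) (h3 s t c d)
    simpa [convL_apply] using this
  have h1 : (convL.flip h).comp (convL.flip g) = convL.flip (conv g h) :=
    ext_delta fun s c => by
      have := congrArg (fun φ => φ g) (h2 s c)
      simpa [convL_apply] using this
  have := congrArg (fun φ => φ f) h1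
  simpa [convL_apply] using this

instance : Mul (SemigroupAlgebraL1 S) := ⟨conv⟩

theorem mul_def (f g : SemigroupAlgebraL1 S) : f * g = conv f g := rfl

/-- `ℓ¹(S)` with convolution is a (not necessarily unital) Banach algebra. -/
instance instNonUnitalNormedRing : NonUnitalNormedRing (SemigroupAlgebraL1 S) where
  __ := (inferInstance : NormedAddCommGroup (SemigroupAlgebraL1 S))
  mul := conv
  left_distrib := conv_add
  right_distrib := add_conv
  zero_mul f := by
    have h := smul_conv (0 : ℂ) (0 : SemigroupAlgebraL1 S) f
    rw [zero_smul, zero_smul] at h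
    exact h
  mul_zero f := by
    have h := conv_smul (0 : ℂ) f (0 : SemigroupAlgebraL1 S)
    rw [zero_smul, zero_smul] at h
    exact h
  mul_assoc := conv_assoc
  norm_mul_le := norm_conv_le

instance : IsScalarTower ℂ (SemigroupAlgebraL1 S) (SemigroupAlgebraL1 S) :=
  ⟨fun c f g => smul_conv c f g⟩

instance : SMulCommClass ℂ (SemigroupAlgebraL1 S) (SemigroupAlgebraL1 S) :=
  ⟨fun c f g => (conv_smul c f g).symm⟩

end SemigroupAlgebraL1

/-! ### Banach bimodules and their duals -/

section Bimodule

variable (A : Type u) [NonUnitalNormedRing A] [NormedSpace ℂ A] [IsScalarTower ℂ A A]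
  [SMulCommClass ℂ A A]

/-- A Banach `A`-bimodule structure on the Banach space `X`: commuting, jointly continuous
left and right actions, `left a x = a · x` and `right a x = x · a`. -/
structure BanachBimodule (X : Type v) [NormedAddCommGroup X] [NormedSpace ℂ X] where
  left : A →L[ℂ] X →L[ℂ] X
  right : A →L[ℂ] X →L[ℂ] X
  left_mul : ∀ a b x, left (a * b) x = left a (left b x)
  right_mul : ∀ a b x, right (a * b) x = right b (right a x)
  left_right : ∀ a b x, left a (right b x) = right b (left a x)

variable {A}

/-- The adjoint `T* : Y* → X*` of a bounded operator, as a bounded linear function of `T`. -/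
def adjointL (X : Type*) (Y : Type*) [NormedAddCommGroup X] [NormedSpace ℂ X]
    [NormedAddCommGroup Y] [NormedSpace ℂ Y] :
    (X →L[ℂ] Y) →L[ℂ] StrongDual ℂ Y →L[ℂ] StrongDual ℂ X :=
  (ContinuousLinearMap.compL ℂ X Y ℂ).flip

@[simp]
theorem adjointL_apply {X : Type*} {Y : Type*} [NormedAddCommGroup X] [NormedSpace ℂ X]
    [NormedAddCommGroup Y] [NormedSpace ℂ Y] (T : X →L[ℂ] Y) (f : StrongDual ℂ Y) (x : X) :
    adjointL X Y T f x = f (T x) := rfl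

/-- The dual bimodule: `(a · f)(x) = f(x · a)` and `(f · a)(x) = f(a · x)`. -/
def BanachBimodule.dual {X : Type v} [NormedAddCommGroup X] [NormedSpace ℂ X]
    (M : BanachBimodule A X) : BanachBimodule A (StrongDual ℂ X) where
  left := (adjointL X X).comp M.right
  right := (adjointL X X).comp M.left
  left_mul a b f := by ext x; simp [M.right_mul]
  right_mul a b f := by ext x; simp [M.left_mul]
  left_right a b f := by ext x; simp [M.left_right]

variable (A)

/-- `A` as a bimodule over itself. -/
def BanachBimodule.self : BanachBimodule A A where
  left := ContinuousLinearMap.mul ℂ A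
  right := (ContinuousLinearMap.mul ℂ A).flip
  left_mul a b x := by simp [mul_assoc]
  right_mul a b x := by simp [mul_assoc]
  left_right a b x := by simp [mul_assoc]

/-! ### The projective tensor product `A ⊗_p A` -/

/-- The algebraic tensor product `A ⊗ A`; as a `PiTensorProduct` it carries the projective
seminorm. -/
abbrev AlgTensor (A : Type u) [NonUnitalNormedRing A] [NormedSpace ℂ A] : Type u :=
  ⨂[ℂ] _ : Fin 2, A

/-- The projective tensor product `A ⊗_p A`: the completion for the projective norm. -/
abbrev ProjTensor (A : Type u) [NonUnitalNormedRing A] [NormedSpace ℂ A] : Type u :=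
  Completion (AlgTensor A)

variable {A}

/-- Extension by continuity from a seminormed space to its completion. -/
def completionExtend (E : Type*) (F : Type*) [SeminormedAddCommGroup E] [NormedSpace ℂ E]
    [NormedAddCommGroup F] [NormedSpace ℂ F] [CompleteSpace F] :
    (E →L[ℂ] F) →L[ℂ] Completion E →L[ℂ] F :=
  LinearMap.mkContinuous₂
    (LinearMap.mk₂ ℂ (fun (φ : E →L[ℂ] F) (x : Completion E) => Completion.extension φ x)
      (fun φ ψ x => by
        induction x using Completion.induction_on with
        | hp => exact isClosed_eq Completion.continuous_extension
                  (Completion.continuous_extension.add Completion.continuous_extension)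
        | ih x =>
          rw [Completion.extension_coe (φ + ψ).uniformContinuous,
            Completion.extension_coe φ.uniformContinuous,
            Completion.extension_coe ψ.uniformContinuous, add_apply])
      (fun c φ x => by
        induction x using Completion.induction_on with
        | hp => exact isClosed_eq Completion.continuous_extension
                  (Completion.continuous_extension.const_smul c)
        | ih x =>
          rw [Completion.extension_coe (c • φ).uniformContinuous,
            Completion.extension_coe φ.uniformContinuous, smul_apply])
      (fun φ x y => by
        induction x, y using Completion.induction_on₂ with
        | hp => exact isClosed_eq (Completion.continuous_extension.comp continuous_add)
                  ((Completion.continuous_extension.comp continuous_fst).add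
                    (Completion.continuous_extension.comp continuous_snd))
        | ih x y =>
          rw [← Completion.coe_add]
          simp [Completion.extension_coe (ContinuousLinearMap.uniformContinuous _)])
      (fun c φ x => by
        induction x using Completion.induction_on with
        | hp => exact isClosed_eq (Completion.continuous_extension.comp (continuous_const_smul c))
                  (Completion.continuous_extension.const_smul c)
        | ih x =>
          rw [← Completion.coe_smul, Completion.extension_coe φ.uniformContinuous,
            Completion.extension_coe φ.uniformContinuous, map_smul]))
    1 (fun φ x => by
      induction x using Completion.induction_on with
      | hp => exact isClosed_le (Completion.continuous_extension.norm)
                (continuous_const.mul continuous_norm)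
      | ih x =>
        simpa [Completion.extension_coe (ContinuousLinearMap.uniformContinuous _)]
          using φ.le_opNorm x)

@[simp]
theorem completionExtend_coe {E : Type*} {F : Type*} [SeminormedAddCommGroup E]
    [NormedSpace ℂ E] [NormedAddCommGroup F] [NormedSpace ℂ F] [CompleteSpace F]
    (φ : E →L[ℂ] F) (x : E) : completionExtend E F φ (x : Completion E) = φ x :=
  Completion.extension_coe φ.uniformContinuous x

variable (A)

/-- The elementary tensor `a ⊗ b` in `A ⊗_p A`. -/
def ProjTensor.tmul {A : Type u} [NonUnitalNormedRing A] [NormedSpace ℂ A] (a b : A) :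
    ProjTensor A :=
  ((PiTensorProduct.tprod ℂ ![a, b] : AlgTensor A) : ProjTensor A)

/-- Two bounded operators on `A ⊗_p A` (or into any normed space) that agree on elementary
tensors are equal. -/
theorem ProjTensor.ext_tmul {A : Type u} [NonUnitalNormedRing A] [NormedSpace ℂ A]
    {F : Type*} [NormedAddCommGroup F] [NormedSpace ℂ F] {φ ψ : ProjTensor A →L[ℂ] F}
    (h : ∀ a b, φ (tmul a b) = ψ (tmul a b)) : φ = ψ := by
  have key : (φ.comp (Completion.toComplL (𝕜 := ℂ) (E := AlgTensor A))).toLinearMap =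
      (ψ.comp (Completion.toComplL (𝕜 := ℂ) (E := AlgTensor A))).toLinearMap := by
    refine PiTensorProduct.ext (MultilinearMap.ext fun m => ?_)
    have hm : m = ![m 0, m 1] := by ext i; fin_cases i <;> rfl
    rw [hm]
    exact h (m 0) (m 1)
  ext x
  induction x using Completion.induction_on with
  | hp => exact isClosed_eq φ.continuous ψ.continuous
  | ih x => exact LinearMap.congr_fun key x

/-- Left action on the algebraic tensor product, `a · (b ⊗ c) = ab ⊗ c`. -/
def AlgTensor.left : A →L[ℂ] AlgTensor A →L[ℂ] AlgTensor A :=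
  ((PiTensorProduct.mapLMultilinear ℂ (fun _ : Fin 2 => A) (fun _ : Fin 2 => A)
    ).toContinuousLinearMap (fun _ => ContinuousLinearMap.id ℂ A) 0).comp
    (ContinuousLinearMap.mul ℂ A)

/-- Right action on the algebraic tensor product, `(b ⊗ c) · a = b ⊗ ca`. -/
def AlgTensor.right : A →L[ℂ] AlgTensor A →L[ℂ] AlgTensor A :=
  ((PiTensorProduct.mapLMultilinear ℂ (fun _ : Fin 2 => A) (fun _ : Fin 2 => A)
    ).toContinuousLinearMap (fun _ => ContinuousLinearMap.id ℂ A) 1).comp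
    (ContinuousLinearMap.mul ℂ A).flip

/-- Bounded operators on `A ⊗ A` extend to bounded operators on `A ⊗_p A`. -/
def ProjTensor.extendOp : (AlgTensor A →L[ℂ] AlgTensor A) →L[ℂ] ProjTensor A →L[ℂ] ProjTensor A :=
  (completionExtend (AlgTensor A) (ProjTensor A)).comp
    (ContinuousLinearMap.compL ℂ (AlgTensor A) (AlgTensor A) (ProjTensor A) Completion.toComplL)

variable {A} in
theorem ProjTensor.left_tmul (a b c : A) :
    ProjTensor.extendOp A (AlgTensor.left A a) (tmul b c) = tmul (a * b) c := by
  simp only [extendOp, tmul, ContinuousLinearMap.comp_apply, completionExtend_coe,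
    ContinuousLinearMap.compL_apply, Completion.coe_toComplL]
  congr 1
  change PiTensorProduct.mapL (Function.update (fun _ => ContinuousLinearMap.id ℂ A) 0
    (ContinuousLinearMap.mul ℂ A a)) (PiTensorProduct.tprod ℂ ![b, c]) = _
  rw [PiTensorProduct.mapL_apply, PiTensorProduct.map_tprod]
  congr 1
  ext i
  fin_cases i <;> simp

variable {A} in
theorem ProjTensor.right_tmul (a b c : A) :
    ProjTensor.extendOp A (AlgTensor.right A a) (tmul b c) = tmul b (c * a) := by
  simp only [extendOp, tmul, ContinuousLinearMap.comp_apply, completionExtend_coe,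
    ContinuousLinearMap.compL_apply, Completion.coe_toComplL]
  congr 1
  change PiTensorProduct.mapL (Function.update (fun _ => ContinuousLinearMap.id ℂ A) 1
    ((ContinuousLinearMap.mul ℂ A).flip a)) (PiTensorProduct.tprod ℂ ![b, c]) = _
  rw [PiTensorProduct.mapL_apply, PiTensorProduct.map_tprod]
  congr 1
  ext i
  fin_cases i <;> simp

/-- The Banach `A`-bimodule `A ⊗_p A`, with `a · (b ⊗ c) = ab ⊗ c` and `(b ⊗ c) · a = b ⊗ ca`. -/
def BanachBimodule.projTensor : BanachBimodule A (ProjTensor A) where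
  left := (ProjTensor.extendOp A).comp (AlgTensor.left A)
  right := (ProjTensor.extendOp A).comp (AlgTensor.right A)
  left_mul a b x := by
    have : ProjTensor.extendOp A (AlgTensor.left A (a * b)) =
        (ProjTensor.extendOp A (AlgTensor.left A a)).comp
          (ProjTensor.extendOp A (AlgTensor.left A b)) :=
      ProjTensor.ext_tmul fun c d => by simp [ProjTensor.left_tmul, mul_assoc]
    exact congrArg (fun φ => φ x) this
  right_mul a b x := by
    have : ProjTensor.extendOp A (AlgTensor.right A (a * b)) =
        (ProjTensor.extendOp A (AlgTensor.right A b)).comp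
          (ProjTensor.extendOp A (AlgTensor.right A a)) :=
      ProjTensor.ext_tmul fun c d => by simp [ProjTensor.right_tmul, mul_assoc]
    exact congrArg (fun φ => φ x) this
  left_right a b x := by
    have : (ProjTensor.extendOp A (AlgTensor.left A a)).comp
          (ProjTensor.extendOp A (AlgTensor.right A b)) =
        (ProjTensor.extendOp A (AlgTensor.right A b)).comp
          (ProjTensor.extendOp A (AlgTensor.left A a)) :=
      ProjTensor.ext_tmul fun c d => by simp [ProjTensor.left_tmul, ProjTensor.right_tmul]
    exact congrArg (fun φ => φ x) this

/-- Multiplication of `A` as a bounded bilinear map, in the form of a multilinear map. -/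
def mulMultilinear : ContinuousMultilinearMap ℂ (fun _ : Fin 2 => A) A :=
  MultilinearMap.mkContinuous
    { toFun := fun m => m 0 * m 1
      map_update_add' := by
        intro _ m i x y
        fin_cases i <;> simp [add_mul, mul_add]
      map_update_smul' := by
        intro _ m i c x
        fin_cases i
        · simpa using smul_mul_assoc c x (m 1)
        · simpa using mul_smul_comm c (m 0) x }
    1 (fun m => by simpa [Fin.prod_univ_two] using norm_mul_le (m 0) (m 1))

/-- The product morphism `π_A : A ⊗_p A → A`, `π_A(a ⊗ b) = ab`. -/
def productMorphism [CompleteSpace A] : ProjTensor A →L[ℂ] A :=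
  completionExtend (AlgTensor A) A
    (PiTensorProduct.liftIsometry ℂ (fun _ : Fin 2 => A) A (mulMultilinear A))

theorem productMorphism_tmul [CompleteSpace A] (a b : A) :
    productMorphism A (ProjTensor.tmul a b) = a * b := by
  simp [productMorphism, ProjTensor.tmul, mulMultilinear]

/-- The second adjoint `T** : X** → Y**` of a bounded operator `T : X → Y`. -/
def secondAdjoint {X : Type*} {Y : Type*} [NormedAddCommGroup X] [NormedSpace ℂ X]
    [NormedAddCommGroup Y] [NormedSpace ℂ Y] (T : X →L[ℂ] Y) :
    StrongDual ℂ (StrongDual ℂ X) →L[ℂ] StrongDual ℂ (StrongDual ℂ Y) :=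
  adjointL (StrongDual ℂ Y) (StrongDual ℂ X) (adjointL X Y T)

/-! ### Notions of amenability -/

/-- `A` is strong pseudo-amenable: there is a (not necessarily bounded) net `(m_α)` in
`(A ⊗_p A)**` with `a · m_α - m_α · a → 0` and `a π**(m_α) = π**(m_α) a → a` in norm,
for all `a ∈ A`. -/
def IsStrongPseudoAmenable [CompleteSpace A] : Prop :=
  ∃ (ι : Type u) (_ : Preorder ι) (_ : IsDirectedOrder ι) (_ : Nonempty ι)
    (m : ι → StrongDual ℂ (StrongDual ℂ (ProjTensor A))),
    ∀ a : A,
      Tendsto (fun α => (BanachBimodule.projTensor A).dual.dual.left a (m α) -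
          (BanachBimodule.projTensor A).dual.dual.right a (m α)) atTop (𝓝 0) ∧
      (∀ α, (BanachBimodule.self A).dual.dual.left a (secondAdjoint (productMorphism A) (m α)) =
          (BanachBimodule.self A).dual.dual.right a (secondAdjoint (productMorphism A) (m α))) ∧
      Tendsto (fun α =>
          (BanachBimodule.self A).dual.dual.left a (secondAdjoint (productMorphism A) (m α)))
        atTop (𝓝 (NormedSpace.inclusionInDoubleDual ℂ A a))

/-- `A` is approximately amenable: every bounded derivation `D : A → X*` into the dual of a
Banach `A`-bimodule `X` is the pointwise norm limit of a net of inner derivations. -/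
def IsApproximatelyAmenable : Prop :=
  ∀ (X : Type u) [NormedAddCommGroup X] [NormedSpace ℂ X] [CompleteSpace X]
    (M : BanachBimodule A X) (D : A →L[ℂ] StrongDual ℂ X),
    (∀ a b, D (a * b) = M.dual.left a (D b) + M.dual.right b (D a)) →
    ∃ (ι : Type u) (_ : Preorder ι) (_ : IsDirectedOrder ι) (_ : Nonempty ι)
      (x : ι → StrongDual ℂ X),
      ∀ a : A, Tendsto (fun α => M.dual.left a (x α) - M.dual.right a (x α)) atTop (𝓝 (D a))

end Bimodule

/-- The left translate `x ↦ f (g⁻¹ x)` of a bounded real function on a group. -/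
def leftTranslate {G : Type u} [Group G] (g : G) (f : lp (fun _ : G => ℝ) ∞) :
    lp (fun _ : G => ℝ) ∞ :=
  ⟨fun x => f (g⁻¹ * x), memℓp_infty (by
    obtain ⟨C, hC⟩ := (memℓp_infty_iff.1 (lp.memℓp f))
    exact ⟨C, by rintro _ ⟨x, rfl⟩; exact hC ⟨g⁻¹ * x, rfl⟩⟩)⟩

/-- The (discrete) group `G` is amenable: there is a left-invariant mean on `ℓ^∞(G)`. -/
def IsAmenableGroup (G : Type u) [Group G] : Prop :=
  ∃ μ : lp (fun _ : G => ℝ) ∞ →ₗ[ℝ] ℝ,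
    μ 1 = 1 ∧ (∀ f : lp (fun _ : G => ℝ) ∞, (∀ x, 0 ≤ f x) → 0 ≤ μ f) ∧
      ∀ (g : G) (f : lp (fun _ : G => ℝ) ∞), μ (leftTranslate g f) = μ f

/-! ### Brandt semigroups -/

/-- The Brandt semigroup `M⁰(G, I)`: the elements `(g)_{i,j}` together with a zero. -/
inductive BrandtSemigroup (G : Type u) (I : Type v) : Type (max u v)
  | zero : BrandtSemigroup G I
  | entry (g : G) (i j : I) : BrandtSemigroup G I

namespace BrandtSemigroup

variable {G : Type u} {I : Type v} [Group G]

open scoped Classical in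
/-- `(g)_{i,j} (h)_{k,l} = (gh)_{i,l}` if `j = k`, and all other products are zero. -/
def mul : BrandtSemigroup G I → BrandtSemigroup G I → BrandtSemigroup G I
  | entry g i j, entry h k l => if j = k then entry (g * h) i l else zero
  | _, _ => zero

instance : Semigroup (BrandtSemigroup G I) where
  mul := mul
  mul_assoc a b c := by
    change mul (mul a b) c = mul a (mul b c)
    rcases a with _ | ⟨g, i, j⟩ <;> rcases b with _ | ⟨h, k, l⟩ <;> rcases c with _ | ⟨r, m, n⟩ <;>
      simp only [mul]
    · split_ifs <;> rfl
    · by_cases h1 : j = k <;> by_cases h2 : l = m <;> simp [h1, h2, mul_assoc]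

end BrandtSemigroup

end

-- For finite `I` the elements `δ_{(g)_{i,j}} - δ_0` multiply like group elements times matrix units
-- and annihilate `δ_0`, so `ℓ¹(S)` is `M_n(ℓ¹(G)) ⊕ ℂ`, a unital algebra. If `G` is amenable,
-- averaging `∑ᵢ (g)_{i,o} ⊗ (g⁻¹)_{o,i}` over `g` with an invariant mean, and adding `δ_0 ⊗ δ_0`,
-- gives a virtual diagonal (`exists_isVirtualDiagonal`). From it both amenability properties follow
-- with constant nets.
--
-- Conversely, amenability of `G` is always reached through `IsAmenableGroup.of_almost_invariant`:
-- it suffices to have functionals on `ℓ^∞(G)` that are nearly invariant under finitely many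
-- translations and at least `1/2` at `1`, with no uniform bound on their norms. Under strong
-- pseudo-amenability such functionals arise by testing `m_α` on the forms `cornerForm o f`, which
-- see only the group coordinate of the left tensor factor. Under approximate amenability they arise
-- as `δ_1 - x`, where `x` nearly implements a derivation `(g)_{i,j} ↦ δ_{(g,i,j)} - δ_{(1,i,j)}`
-- into the dual of a module of bounded functions modulo functions constant in `G`.
--
-- Finiteness of `I` under strong pseudo-amenability comes from the exact centrality of `π**(m_α)`:
-- it takes the same nonzero value on every diagonal block sum, while sums of these functionals over
-- finite sets of blocks have norm at most one (`finite_of_central`).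
--
-- Finiteness of `I` under approximate amenability is the delicate part. Adjoin to `I` a point `∞`
-- that the semigroup treats as the formal sum of all points, and consider `a ↦ a ⊗ ∞ - ∞ ⊗ a`. If
-- `I` is infinite, choose disjoint blocks of sizes `4ⁿ` and two elements of `ℓ¹(S)`, weighted sums
-- of the block idempotents of even and of odd index. A functional nearly implementing the
-- derivation on just these two elements has averages over successive blocks that start near `1` and
-- move by summably small steps of total less than `1/2`; but a bounded functional has averages
-- tending to zero (`BlockSystem.not_almost_inner`).

universe u v

noncomputable section

/-! ### Bounded families on a semigroup and maps out of `ℓ¹(S)` -/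

namespace SemigroupAlgebraL1

section Lift

variable {S : Type u} {Y : Type*} [NormedAddCommGroup Y] [NormedSpace ℂ Y]

theorem norm_smul_family_le {v : S → Y} {C : ℝ} (hv : ∀ s, ‖v s‖ ≤ C) (a : SemigroupAlgebraL1 S)
    (s : S) : ‖a s • v s‖ ≤ ‖a s‖ * C := by
  rw [norm_smul]
  exact mul_le_mul_of_nonneg_left (hv s) (norm_nonneg _)

variable [CompleteSpace Y]

theorem summable_smul_family {v : S → Y} {C : ℝ} (hv : ∀ s, ‖v s‖ ≤ C)
    (a : SemigroupAlgebraL1 S) : Summable fun s => a s • v s :=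
  Summable.of_norm_bounded ((summable_norm a).mul_right C) (norm_smul_family_le hv a)

/-- The bounded operator `ℓ¹(S) → Y` that sends `δ_s` to `v s`, for a bounded family `v`. -/
def lift (v : S → Y) (C : ℝ) (hv : ∀ s, ‖v s‖ ≤ C) : SemigroupAlgebraL1 S →L[ℂ] Y :=
  LinearMap.mkContinuous
    { toFun := fun a => ∑' s, a s • v s
      map_add' := fun a b => by
        rw [← (summable_smul_family hv a).tsum_add (summable_smul_family hv b)]
        exact tsum_congr fun s => by rw [lp.coeFn_add, Pi.add_apply, add_smul]
      map_smul' := fun c a => by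
        rw [RingHom.id_apply, ← (summable_smul_family hv a).tsum_const_smul c]
        exact tsum_congr fun s => by rw [lp.coeFn_smul, Pi.smul_apply, smul_eq_mul, mul_smul] }
    C (fun a => by
      rw [mul_comm, norm_eq, ← tsum_mul_right]
      exact tsum_of_norm_bounded ((summable_norm a).mul_right C).hasSum
        (norm_smul_family_le hv a))

theorem norm_lift_le {v : S → Y} {C : ℝ} (hv : ∀ s, ‖v s‖ ≤ C) (hC : 0 ≤ C) :
    ‖lift v C hv‖ ≤ C :=
  LinearMap.mkContinuous_norm_le _ hC _

@[simp]
theorem lift_delta {v : S → Y} {C : ℝ} (hv : ∀ s, ‖v s‖ ≤ C) (s : S) (c : ℂ) :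
    lift v C hv (delta s c) = c • v s := by
  classical
  change ∑' t, (delta s c) t • v t = _
  rw [tsum_eq_single s]
  · rw [show (delta s c) s = c from lp.single_apply_self (E := fun _ : S => ℂ) 1 s c]
  · intro t ht
    rw [show (delta s c) t = 0 from lp.single_apply_ne (E := fun _ : S => ℂ) 1 s c ht, zero_smul]

end Lift

theorem delta_eq_smul {S : Type u} (s : S) (c : ℂ) : delta s c = c • delta s 1 := by
  rw [← delta_smul, mul_one]

theorem ext_delta_one {S : Type u} {F : Type*} [NormedAddCommGroup F] [NormedSpace ℂ F]
    {φ ψ : SemigroupAlgebraL1 S →L[ℂ] F} (h : ∀ s, φ (delta s 1) = ψ (delta s 1)) : φ = ψ :=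
  ext_delta fun s c => by rw [delta_eq_smul, map_smul, map_smul, h]

theorem ext_delta₂ {S : Type u} {F : Type*} [NormedAddCommGroup F] [NormedSpace ℂ F]
    {φ ψ : SemigroupAlgebraL1 S →L[ℂ] SemigroupAlgebraL1 S →L[ℂ] F}
    (h : ∀ s t, φ (delta s 1) (delta t 1) = ψ (delta s 1) (delta t 1)) : φ = ψ :=
  ext_delta_one fun s => ext_delta_one fun t => h s t

variable {S : Type u} [Semigroup S]

@[simp]
theorem delta_mul_delta (s t : S) (c d : ℂ) : delta s c * delta t d = delta (s * t) (c * d) :=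
  conv_delta s t c d

variable {X : Type v} [NormedAddCommGroup X] [NormedSpace ℂ X]

/-- The `ℓ¹(S)`-bimodule given by uniformly bounded commuting left and right actions of `S`. -/
def bimodule [CompleteSpace X] (L R : S → X →L[ℂ] X) (C : ℝ) (hL : ∀ s, ‖L s‖ ≤ C)
    (hR : ∀ s, ‖R s‖ ≤ C)
    (hLL : ∀ s t x, L (s * t) x = L s (L t x)) (hRR : ∀ s t x, R (s * t) x = R t (R s x))
    (hLR : ∀ s t x, L s (R t x) = R t (L s x)) : BanachBimodule (SemigroupAlgebraL1 S) X where
  left := lift L C hL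
  right := lift R C hR
  left_mul a b x := by
    have : (ContinuousLinearMap.compL ℂ _ _ _ (lift L C hL)).comp
        (ContinuousLinearMap.mul ℂ (SemigroupAlgebraL1 S)) =
        (ContinuousLinearMap.compL ℂ X X X).bilinearComp (lift L C hL) (lift L C hL) :=
      ext_delta₂ fun s t => by ext y; simp [hLL]
    exact congrArg (fun φ => φ a b x) this
  right_mul a b x := by
    have : (ContinuousLinearMap.compL ℂ _ _ _ (lift R C hR)).comp
        (ContinuousLinearMap.mul ℂ (SemigroupAlgebraL1 S)) =
        (ContinuousLinearMap.compL ℂ X X X).flip.bilinearComp (lift R C hR) (lift R C hR) :=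
      ext_delta₂ fun s t => by ext y; simp [hRR]
    exact congrArg (fun φ => φ a b x) this
  left_right a b x := by
    have : (ContinuousLinearMap.compL ℂ X X X).bilinearComp (lift L C hL) (lift R C hR) =
        (ContinuousLinearMap.compL ℂ X X X).flip.bilinearComp (lift L C hL) (lift R C hR) :=
      ext_delta₂ fun s t => by ext y; simp [hLR]
    exact congrArg (fun φ => φ a b x) this

section

variable [CompleteSpace X] {L R : S → X →L[ℂ] X} {C : ℝ} {hL : ∀ s, ‖L s‖ ≤ C}
  {hR : ∀ s, ‖R s‖ ≤ C} {hLL : ∀ s t x, L (s * t) x = L s (L t x)}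
  {hRR : ∀ s t x, R (s * t) x = R t (R s x)} {hLR : ∀ s t x, L s (R t x) = R t (L s x)}

theorem bimodule_left_delta (s : S) :
    (bimodule L R C hL hR hLL hRR hLR).left (delta s 1) = L s := by
  simp [bimodule]

theorem bimodule_right_delta (s : S) :
    (bimodule L R C hL hR hLL hRR hLR).right (delta s 1) = R s := by
  simp [bimodule]

end

/-- A map into the dual of a bimodule that satisfies the Leibniz rule on point masses is a
derivation. -/
theorem leibniz_of_delta (M : BanachBimodule (SemigroupAlgebraL1 S) X)
    (D : SemigroupAlgebraL1 S →L[ℂ] StrongDual ℂ X)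
    (h : ∀ s t, D (delta (s * t) 1) =
      M.dual.left (delta s 1) (D (delta t 1)) + M.dual.right (delta t 1) (D (delta s 1)))
    (a b : SemigroupAlgebraL1 S) :
    D (a * b) = M.dual.left a (D b) + M.dual.right b (D a) := by
  have : (ContinuousLinearMap.compL ℂ _ _ _ D).comp
      (ContinuousLinearMap.mul ℂ (SemigroupAlgebraL1 S)) =
      M.dual.left.bilinearComp (.id ℂ _) D + M.dual.right.flip.bilinearComp D (.id ℂ _) :=
    ext_delta₂ fun s t => by simpa using h s t
  exact congrArg (fun φ => φ a b) this

end SemigroupAlgebraL1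

/-! ### Maps out of the projective tensor product -/

namespace ProjTensor

variable {A : Type u} [NonUnitalNormedRing A] [NormedSpace ℂ A]
  {F : Type*} [NormedAddCommGroup F] [NormedSpace ℂ F]

/-- A bounded bilinear map as a multilinear map on a family indexed by `Fin 2`. -/
def bilinMultilinear (B : A →L[ℂ] A →L[ℂ] F) : ContinuousMultilinearMap ℂ (fun _ : Fin 2 => A) F :=
  MultilinearMap.mkContinuous
    { toFun := fun m => B (m 0) (m 1)
      map_update_add' := by
        intro _ m i x y
        fin_cases i <;> simp
      map_update_smul' := by
        intro _ m i c x
        fin_cases i <;> simp }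
    ‖B‖ (fun m => by simpa [Fin.prod_univ_two, mul_assoc] using B.le_opNorm₂ (m 0) (m 1))

theorem norm_bilinMultilinear_le (B : A →L[ℂ] A →L[ℂ] F) : ‖bilinMultilinear B‖ ≤ ‖B‖ :=
  MultilinearMap.mkContinuous_norm_le _ (norm_nonneg B) _

variable [CompleteSpace F]

theorem completionExtend_norm_le {E : Type*} [SeminormedAddCommGroup E] [NormedSpace ℂ E]
    (φ : E →L[ℂ] F) : ‖completionExtend E F φ‖ ≤ ‖φ‖ := by
  refine (ContinuousLinearMap.le_opNorm _ _).trans ?_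
  have : ‖completionExtend E F‖ ≤ 1 := LinearMap.mkContinuous₂_norm_le _ zero_le_one _
  simpa using mul_le_mul_of_nonneg_right this (norm_nonneg φ)

theorem completionExtend_lift_tmul (B : A →L[ℂ] A →L[ℂ] F) (a b : A) :
    completionExtend (AlgTensor A) F (PiTensorProduct.liftIsometry ℂ (fun _ : Fin 2 => A) F
      (bilinMultilinear B)) (tmul a b) = B a b := by
  simp [tmul, bilinMultilinear]

/-- The extension of a bounded bilinear map to the projective tensor product. -/
def lift : (A →L[ℂ] A →L[ℂ] F) →L[ℂ] ProjTensor A →L[ℂ] F :=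
  LinearMap.mkContinuous
    { toFun := fun B => completionExtend (AlgTensor A) F
        (PiTensorProduct.liftIsometry ℂ (fun _ : Fin 2 => A) F (bilinMultilinear B))
      map_add' := fun B C => ext_tmul fun a b => by
        rw [add_apply]; simp only [completionExtend_lift_tmul, add_apply]
      map_smul' := fun c B => ext_tmul fun a b => by
        rw [smul_apply]; simp only [completionExtend_lift_tmul, smul_apply, RingHom.id_apply] }
    1 (fun B => by
      rw [one_mul]
      refine (completionExtend_norm_le _).trans ?_
      rw [LinearIsometryEquiv.norm_map]
      exact norm_bilinMultilinear_le B)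

@[simp]
theorem lift_tmul (B : A →L[ℂ] A →L[ℂ] F) (a b : A) : lift B (tmul a b) = B a b :=
  completionExtend_lift_tmul B a b

theorem norm_lift_le (B : A →L[ℂ] A →L[ℂ] F) : ‖lift B‖ ≤ ‖B‖ := by
  refine (completionExtend_norm_le _).trans ?_
  rw [LinearIsometryEquiv.norm_map]
  exact norm_bilinMultilinear_le B

theorem update_pair_zero {α : Type*} (a b c : α) : Function.update ![a, b] 0 c = ![c, b] := by
  ext i; fin_cases i <;> rfl

theorem update_pair_one {α : Type*} (a b c : α) : Function.update ![a, b] 1 c = ![a, c] := by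
  ext i; fin_cases i <;> rfl

theorem norm_tmul_le (a b : A) : ‖tmul a b‖ ≤ ‖a‖ * ‖b‖ := by
  have := PiTensorProduct.projectiveSeminorm_tprod_le (𝕜 := ℂ) (E := fun _ : Fin 2 => A) ![a, b]
  simpa [tmul, Fin.prod_univ_two] using this

variable (A) in
/-- The elementary tensor `a ⊗ b` as a bounded bilinear map of `a` and `b`. -/
def tmulL : A →L[ℂ] A →L[ℂ] ProjTensor A :=
  LinearMap.mkContinuous₂
    (LinearMap.mk₂ ℂ tmul
      (fun a b c => by
        have h := (PiTensorProduct.tprod ℂ (s := fun _ : Fin 2 => A)).map_update_add ![a, c] 0 a b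
        simp only [tmul, ← Completion.coe_add]
        congr 1
        simpa only [update_pair_zero] using h)
      (fun r a c => by
        have h := (PiTensorProduct.tprod ℂ (s := fun _ : Fin 2 => A)).map_update_smul ![a, c] 0 r a
        simp only [tmul, ← Completion.coe_smul]
        congr 1
        simpa only [update_pair_zero] using h)
      (fun a b c => by
        have h := (PiTensorProduct.tprod ℂ (s := fun _ : Fin 2 => A)).map_update_add ![a, c] 1 b c
        simp only [tmul, ← Completion.coe_add]
        congr 1
        simpa only [update_pair_one] using h)
      (fun r a c => by
        have h := (PiTensorProduct.tprod ℂ (s := fun _ : Fin 2 => A)).map_update_smul ![a, c] 1 r c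
        simp only [tmul, ← Completion.coe_smul]
        congr 1
        simpa only [update_pair_one] using h))
    1 (fun a b => by simpa using norm_tmul_le a b)

theorem tmulL_apply (a b : A) : tmulL A a b = tmul a b := rfl

@[simp]
theorem tmul_zero (a : A) : tmul a 0 = 0 := by
  rw [← tmulL_apply, map_zero]

@[simp]
theorem zero_tmul (a : A) : tmul 0 a = 0 := by
  rw [← tmulL_apply, map_zero, zero_apply]

theorem ext_delta {S : Type u} [Semigroup S] {F : Type*} [NormedAddCommGroup F] [NormedSpace ℂ F]
    {φ ψ : ProjTensor (SemigroupAlgebraL1 S) →L[ℂ] F}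
    (h : ∀ s t, φ (tmul (.delta s 1) (.delta t 1)) = ψ (tmul (.delta s 1) (.delta t 1))) :
    φ = ψ := by
  have := SemigroupAlgebraL1.ext_delta₂ (φ := (ContinuousLinearMap.compL ℂ _ _ _ φ).comp (tmulL _))
    (ψ := (ContinuousLinearMap.compL ℂ _ _ _ ψ).comp (tmulL _)) h
  exact ext_tmul fun a b => congrArg (fun B => B a b) this

end ProjTensor

/-- Directedness of the net lets one functional serve finitely many elements at once. Nothing
controls its norm as `T` and `ε` vary, so the applications argue with a single functional instead of
passing to a limit. -/
theorem IsApproximatelyAmenable.exists_almost_inner {A : Type u} [NonUnitalNormedRing A]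
    [NormedSpace ℂ A] [IsScalarTower ℂ A A] [SMulCommClass ℂ A A]
    (h : IsApproximatelyAmenable A) {X : Type u} [NormedAddCommGroup X] [NormedSpace ℂ X]
    [CompleteSpace X] (M : BanachBimodule A X) (D : A →L[ℂ] StrongDual ℂ X)
    (hD : ∀ a b, D (a * b) = M.dual.left a (D b) + M.dual.right b (D a))
    (T : Set A) (hT : T.Finite) {ε : ℝ} (hε : 0 < ε) :
    ∃ x : StrongDual ℂ X, ∀ a ∈ T, ‖M.dual.left a x - M.dual.right a x - D a‖ ≤ ε := by
  obtain ⟨ι, _, _, _, x, hx⟩ := h X M D hD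
  have : ∀ᶠ α in atTop, ∀ a ∈ T, ‖M.dual.left a (x α) - M.dual.right a (x α) - D a‖ ≤ ε := by
    refine (eventually_all_finite hT).2 fun a _ => ?_
    filter_upwards [Metric.tendsto_nhds.1 (hx a) ε hε] with α hα
    rw [dist_eq_norm] at hα
    exact hα.le
  obtain ⟨α, hα⟩ := this.exists
  exact ⟨x α, hα⟩

end

noncomputable section

/-! ### Invariant means from almost invariant functionals -/

section AlmostInvariant

variable {G : Type u}

/-- A bounded function as an element of `ℓ^∞`. -/
def linftyMk {α : Type*} {E : Type*} [NormedAddCommGroup E] (f : α → E) (C : ℝ)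
    (hf : ∀ x, ‖f x‖ ≤ C) : lp (fun _ : α => E) ∞ :=
  ⟨f, memℓp_infty ⟨C, by rintro _ ⟨x, rfl⟩; exact hf x⟩⟩

theorem linfty_apply_le {α : Type*} {E : Type*} [NormedAddCommGroup E]
    (f : lp (fun _ : α => E) ∞) (x : α) : ‖f x‖ ≤ ‖f‖ :=
  lp.norm_apply_le_norm ENNReal.top_ne_zero f x

theorem linfty_norm_le_of_le {f g : lp (fun _ : G => ℝ) ∞} (h0 : ∀ x, 0 ≤ f x)
    (h : ∀ x, f x ≤ g x) : ‖f‖ ≤ ‖g‖ :=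
  lp.norm_le_of_forall_le (norm_nonneg _) fun x => by
    rw [Real.norm_of_nonneg (h0 x)]
    exact (h x).trans ((le_abs_self _).trans (linfty_apply_le g x))

/-- The positive part of a bounded functional on `ℓ^∞`, evaluated at a nonnegative function. -/
def positivePart (ρ : lp (fun _ : G => ℝ) ∞ →L[ℝ] ℝ) (f : lp (fun _ : G => ℝ) ∞) : ℝ :=
  sSup {r | ∃ h : lp (fun _ : G => ℝ) ∞, (∀ x, 0 ≤ h x) ∧ (∀ x, h x ≤ f x) ∧ ρ h = r}

variable (ρ : lp (fun _ : G => ℝ) ∞ →L[ℝ] ℝ) {f g h : lp (fun _ : G => ℝ) ∞}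

theorem le_positivePart (h0 : ∀ x, 0 ≤ h x) (hf : ∀ x, h x ≤ f x) : ρ h ≤ positivePart ρ f := by
  refine le_csSup ⟨‖ρ‖ * ‖f‖, ?_⟩ ⟨h, h0, hf, rfl⟩
  rintro _ ⟨k, k0, kf, rfl⟩
  refine (le_abs_self _).trans ((ρ.le_opNorm k).trans ?_)
  exact mul_le_mul_of_nonneg_left (linfty_norm_le_of_le k0 kf) (norm_nonneg _)

theorem positivePart_le (f0 : ∀ x, 0 ≤ f x) {r : ℝ}
    (H : ∀ h : lp (fun _ : G => ℝ) ∞, (∀ x, 0 ≤ h x) → (∀ x, h x ≤ f x) → ρ h ≤ r) :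
    positivePart ρ f ≤ r := by
  refine csSup_le ⟨ρ 0, 0, fun _ => le_rfl, f0, rfl⟩ ?_
  rintro _ ⟨k, k0, kf, rfl⟩
  exact H k k0 kf

theorem positivePart_add (f0 : ∀ x, 0 ≤ f x) (g0 : ∀ x, 0 ≤ g x) :
    positivePart ρ (f + g) = positivePart ρ f + positivePart ρ g := by
  refine le_antisymm ?_ ?_
  · refine positivePart_le ρ (fun x => add_nonneg (f0 x) (g0 x)) fun h h0 hfg => ?_
    -- Riesz decomposition: `h = min h f + (h - min h f)`, with the second summand between `0` and
    -- `g`.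
    let k : lp (fun _ : G => ℝ) ∞ := linftyMk (fun x => min (h x) (f x)) ‖f‖ fun x => by
      rw [Real.norm_of_nonneg (le_min (h0 x) (f0 x))]
      exact (min_le_right _ _).trans ((le_abs_self _).trans (linfty_apply_le f x))
    have h1 : ρ k ≤ positivePart ρ f :=
      le_positivePart ρ (fun x => le_min (h0 x) (f0 x)) fun x => min_le_right _ _
    have h2 : ρ (h - k) ≤ positivePart ρ g := by
      refine le_positivePart ρ (fun x => sub_nonneg.2 (min_le_left _ _)) fun x => ?_
      have := hfg x
      change h x - min (h x) (f x) ≤ g x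
      change h x ≤ f x + g x at this
      rcases le_total (h x) (f x) with hx | hx
      · rw [min_eq_left hx, sub_self]; exact g0 x
      · rw [min_eq_right hx]; linarith
    rw [map_sub] at h2
    linarith
  · rw [← le_sub_iff_add_le]
    refine positivePart_le ρ f0 fun h h0 hf => ?_
    rw [le_sub_comm]
    refine positivePart_le ρ g0 fun k k0 kg => ?_
    rw [le_sub_iff_add_le', ← map_add]
    exact le_positivePart ρ (fun x => add_nonneg (h0 x) (k0 x)) fun x => add_le_add (hf x) (kg x)

theorem positivePart_mono (f0 : ∀ x, 0 ≤ f x) (hfg : ∀ x, f x ≤ g x) :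
    positivePart ρ f ≤ positivePart ρ g :=
  positivePart_le ρ f0 fun _ h0 hf => le_positivePart ρ h0 fun x => (hf x).trans (hfg x)

variable [Group G]

theorem leftTranslate_apply (a : G) (f : lp (fun _ : G => ℝ) ∞) (x : G) :
    leftTranslate a f x = f (a⁻¹ * x) := rfl

theorem leftTranslate_leftTranslate_inv (a : G) (f : lp (fun _ : G => ℝ) ∞) :
    leftTranslate a (leftTranslate a⁻¹ f) = f := by
  ext x
  simp [leftTranslate_apply]

/-- Translation by `a` is a bijection between the functions competing in the two suprema, and every
competitor has norm at most `‖f‖`. -/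
theorem abs_positivePart_leftTranslate_sub_le {a : G} {ε : ℝ} (hε : 0 ≤ ε)
    (H : ∀ f, |ρ (leftTranslate a f) - ρ f| ≤ ε * ‖f‖) (f0 : ∀ x, 0 ≤ f x) :
    |positivePart ρ (leftTranslate a f) - positivePart ρ f| ≤ ε * ‖f‖ := by
  have key : ∀ k : lp (fun _ : G => ℝ) ∞, (∀ x, 0 ≤ k x) → (∀ x, k x ≤ f x) →
      |ρ (leftTranslate a k) - ρ k| ≤ ε * ‖f‖ := fun k k0 kf =>
    (H k).trans (mul_le_mul_of_nonneg_left (linfty_norm_le_of_le k0 kf) hε)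
  rw [abs_sub_le_iff]
  constructor
  · rw [sub_le_iff_le_add]
    refine positivePart_le (f := leftTranslate a f) ρ (fun x => f0 _) fun h h0 hf => ?_
    have k0 : ∀ x, 0 ≤ leftTranslate a⁻¹ h x := fun x => h0 _
    have kf : ∀ x, leftTranslate a⁻¹ h x ≤ f x := fun x => by
      have := hf (a * x)
      rw [leftTranslate_apply] at this ⊢
      simpa using this
    have h1 := (abs_le.1 (key _ k0 kf)).2
    rw [leftTranslate_leftTranslate_inv] at h1
    linarith [le_positivePart ρ k0 kf]
  · rw [sub_le_iff_le_add]
    refine positivePart_le ρ f0 fun h h0 hf => ?_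
    have h1 := (abs_le.1 (key _ h0 hf)).1
    have h2 : ρ (leftTranslate a h) ≤ positivePart ρ (leftTranslate a f) :=
      le_positivePart ρ (fun x => h0 _) fun x => hf _
    linarith

variable (G) in
/-- The span of the differences between bounded functions and their translates. -/
def translateDefects : Submodule ℝ (lp (fun _ : G => ℝ) ∞) :=
  Submodule.span ℝ {n | ∃ (a : G) (f : lp (fun _ : G => ℝ) ∞), n = f - leftTranslate a f}

/-- `positivePart` is meaningful only on nonnegative functions, so `n` is handled as a difference of
two of them. The data `T`, `C`, `p`, `q` depend on `n` alone, which leaves `ε` and `ρ` to be chosen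
afterwards. -/
theorem exists_decomposition_of_mem_translateDefects {n : lp (fun _ : G => ℝ) ∞}
    (hn : n ∈ translateDefects G) :
    ∃ (T : Finset G) (C : ℝ) (p q : lp (fun _ : G => ℝ) ∞), 0 ≤ C ∧ n = p - q ∧
      (∀ x, 0 ≤ p x) ∧ (∀ x, 0 ≤ q x) ∧
      ∀ (ε : ℝ) (ρ : lp (fun _ : G => ℝ) ∞ →L[ℝ] ℝ), 0 ≤ ε →
        (∀ a ∈ T, ∀ f, |ρ (leftTranslate a f) - ρ f| ≤ ε * ‖f‖) →
        positivePart ρ p - positivePart ρ q ≤ C * ε := by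
  classical
  refine Submodule.closure_induction ?_ ?_ ?_ hn
  · refine ⟨∅, 0, 0, 0, le_rfl, by simp, fun _ => le_rfl, fun _ => le_rfl, ?_⟩
    intro ε ρ _ _
    simp
  · rintro m n - - ⟨T, C, p, q, hC, rfl, hp, hq, H⟩ ⟨T', C', p', q', hC', rfl, hp', hq', H'⟩
    refine ⟨T ∪ T', C + C', p + p', q + q', by positivity, by abel,
      fun x => add_nonneg (hp x) (hp' x), fun x => add_nonneg (hq x) (hq' x), ?_⟩
    intro ε ρ hε hρ
    have h1 := H ε ρ hε fun a ha => hρ a (Finset.mem_union_left _ ha)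
    have h2 := H' ε ρ hε fun a ha => hρ a (Finset.mem_union_right _ ha)
    rw [positivePart_add ρ hp hp', positivePart_add ρ hq hq']
    linarith
  · rintro r _ ⟨a, f, rfl⟩
    -- The added constant makes `k` nonnegative and cancels in `k - leftTranslate a k`.
    set k : lp (fun _ : G => ℝ) ∞ := linftyMk (fun x => r * f x + ‖r • f‖) (‖r • f‖ + ‖r • f‖)
      fun x => (norm_add_le _ _).trans (add_le_add (linfty_apply_le (r • f) x) (by simp)) with hk
    have k0 : ∀ x, 0 ≤ k x := fun x => by
      have := (abs_le.1 (linfty_apply_le (r • f) x)).1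
      change -‖r • f‖ ≤ r * f x at this
      change 0 ≤ r * f x + ‖r • f‖
      linarith
    refine ⟨{a}, ‖k‖, k, leftTranslate a k, norm_nonneg _, ?_, k0, fun x => k0 _, ?_⟩
    · ext x
      change r * (f x - f (a⁻¹ * x)) = r * f x + ‖r • f‖ - (r * f (a⁻¹ * x) + ‖r • f‖)
      ring
    · intro ε ρ hε hρ
      have := (abs_le.1 (abs_positivePart_leftTranslate_sub_le ρ hε (hρ a (by simp)) k0)).1
      linarith

/-- The norms of the `ρ` may be unbounded, so no weak-* limit is available. Their positive parts are
still almost invariant and at least `1/2` at `1`, which yields Dixmier's criterion: no translate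
defect is bounded below by a positive constant. The M. Riesz extension theorem then produces the
mean. -/
theorem IsAmenableGroup.of_almost_invariant
    (H : ∀ (T : Finset G) (ε : ℝ), 0 < ε → ∃ ρ : lp (fun _ : G => ℝ) ∞ →L[ℝ] ℝ,
      1 / 2 ≤ ρ 1 ∧ ∀ a ∈ T, ∀ f, |ρ (leftTranslate a f) - ρ f| ≤ ε * ‖f‖) :
    IsAmenableGroup G := by
  have key : ∀ n ∈ translateDefects G, ∀ c : ℝ, (∀ x, c ≤ n x) → c ≤ 0 := by
    intro n hn c hc
    by_contra! hc0
    obtain ⟨T, C, p, q, hC, rfl, hp, hq, K⟩ := exists_decomposition_of_mem_translateDefects hn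
    -- With this tolerance the defect estimate is at most `c / 4`, whereas `q + c ≤ p` and `ρ 1 ≥ 1
    -- / 2` force it to be at least `c / 2`.
    have hε : 0 < c / (4 * (C + 1)) := by positivity
    obtain ⟨ρ, h1, hρ⟩ := H T _ hε
    have h2 := K _ ρ hε.le hρ
    have c1 : ∀ x, 0 ≤ (c • (1 : lp (fun _ : G => ℝ) ∞)) x := fun x => by
      change 0 ≤ c * 1
      linarith
    have h3 : positivePart ρ (q + c • 1) ≤ positivePart ρ p := by
      refine positivePart_mono ρ (fun x => add_nonneg (hq x) (c1 x)) fun x => ?_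
      have := hc x
      change c ≤ p x - q x at this
      change q x + c * 1 ≤ p x
      linarith
    rw [positivePart_add ρ hq c1] at h3
    have h4 : ρ (c • 1) ≤ positivePart ρ (c • 1) := le_positivePart ρ c1 fun x => le_rfl
    rw [map_smul, smul_eq_mul] at h4
    have h5 : C * (c / (4 * (C + 1))) ≤ c / 4 := by
      rw [mul_div_assoc', div_le_div_iff₀ (by positivity) (by norm_num)]
      nlinarith
    nlinarith
  -- Functions that are nonnegative up to a translate defect. Positivity on this cone encodes
  -- positivity and invariance together, since it contains every defect along with its negative.
  let s : PointedCone ℝ (lp (fun _ : G => ℝ) ∞) :=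
    { carrier := {f | ∃ n ∈ translateDefects G, ∀ x, 0 ≤ f x + n x}
      zero_mem' := ⟨0, Submodule.zero_mem _, fun x => by simp⟩
      smul_mem' := by
        rintro c f ⟨n, hn, h⟩
        refine ⟨c.1 • n, Submodule.smul_mem _ _ hn, fun x => ?_⟩
        change 0 ≤ c.1 * f x + c.1 * n x
        rw [← mul_add]
        exact mul_nonneg c.2 (h x)
      add_mem' := by
        rintro f g ⟨n, hn, h⟩ ⟨m, hm, h'⟩
        refine ⟨n + m, Submodule.add_mem _ hn hm, fun x => ?_⟩
        change 0 ≤ (f x + g x) + (n x + m x)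
        linarith [h x, h' x] }
  have one_ne : (1 : lp (fun _ : G => ℝ) ∞) ≠ 0 := fun h => by
    have := congrArg (fun f : lp (fun _ : G => ℝ) ∞ => f 1) h
    exact one_ne_zero this
  obtain ⟨μ, hμ, hpos⟩ := riesz_extension s (LinearPMap.mkSpanSingleton (K := ℝ) 1 (1 : ℝ) one_ne)
    (by
      rintro ⟨x, hx⟩ hxs
      obtain ⟨t, rfl⟩ := Submodule.mem_span_singleton.1 hx
      obtain ⟨n, hn, h⟩ := hxs
      rw [LinearPMap.mkSpanSingleton'_apply, RingHom.id_apply, smul_eq_mul, mul_one]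
      have := key n hn (-t) fun x => by
        have := h x
        change 0 ≤ t * 1 + n x at this
        linarith
      linarith)
    (by
      intro f
      refine ⟨⟨‖f‖ • 1, Submodule.mem_span_singleton.2 ⟨_, rfl⟩⟩, 0, Submodule.zero_mem _, ?_⟩
      intro x
      have := (abs_le.1 (linfty_apply_le f x)).1
      change 0 ≤ ‖f‖ * 1 + f x + 0
      linarith)
  refine ⟨μ, ?_, ?_, ?_⟩
  · exact (hμ ⟨1, Submodule.mem_span_singleton_self _⟩).trans
      (LinearPMap.mkSpanSingleton_apply ℝ ℝ one_ne (1 : ℝ))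
  · intro f hf
    exact hpos f ⟨0, Submodule.zero_mem _, fun x => by simpa using hf x⟩
  · have aux : ∀ n ∈ translateDefects G, 0 ≤ μ n := fun n hn =>
      hpos n ⟨-n, Submodule.neg_mem _ hn, fun x => by simp⟩
    intro a f
    have hn : f - leftTranslate a f ∈ translateDefects G :=
      Submodule.subset_span ⟨a, f, rfl⟩
    have h1 := aux _ hn
    have h2 := aux _ (Submodule.neg_mem _ hn)
    rw [map_neg, map_sub] at h2
    rw [map_sub] at h1
    linarith

/-- The complexification of an invariant mean. -/
theorem IsAmenableGroup.exists_complex_mean (hG : IsAmenableGroup G) :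
    ∃ ν : lp (fun _ : G => ℂ) ∞ →L[ℂ] ℂ,
      (∀ (f : lp (fun _ : G => ℂ) ∞) (c : ℂ), (∀ x, f x = c) → ν f = c) ∧
      ∀ (a : G) (f f' : lp (fun _ : G => ℂ) ∞), (∀ x, f' x = f (a * x)) → ν f' = ν f := by
  obtain ⟨μ, h1, hpos, hinv⟩ := hG
  have bound : ∀ f : lp (fun _ : G => ℝ) ∞, |μ f| ≤ ‖f‖ := fun f => by
    have key : ∀ f : lp (fun _ : G => ℝ) ∞, μ f ≤ ‖f‖ := fun f => by
      have := hpos (‖f‖ • 1 - f) fun x => by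
        change 0 ≤ ‖f‖ * 1 - f x
        linarith [(abs_le.1 (linfty_apply_le f x)).2]
      rw [map_sub, map_smul, h1, smul_eq_mul, mul_one] at this
      linarith
    rw [abs_le']
    refine ⟨key f, ?_⟩
    rw [← map_neg, ← norm_neg]
    exact key _
  let re : lp (fun _ : G => ℂ) ∞ → lp (fun _ : G => ℝ) ∞ := fun f =>
    linftyMk (fun x => (f x).re) ‖f‖ fun x => (Complex.abs_re_le_norm _).trans (linfty_apply_le f x)
  let im : lp (fun _ : G => ℂ) ∞ → lp (fun _ : G => ℝ) ∞ := fun f =>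
    linftyMk (fun x => (f x).im) ‖f‖ fun x => (Complex.abs_im_le_norm _).trans (linfty_apply_le f x)
  have norm_re : ∀ f, ‖re f‖ ≤ ‖f‖ := fun f => lp.norm_le_of_forall_le (norm_nonneg _)
    fun x => (Complex.abs_re_le_norm _).trans (linfty_apply_le f x)
  have norm_im : ∀ f, ‖im f‖ ≤ ‖f‖ := fun f => lp.norm_le_of_forall_le (norm_nonneg _)
    fun x => (Complex.abs_im_le_norm _).trans (linfty_apply_le f x)
  have re_add : ∀ f g, re (f + g) = re f + re g := fun f g => by
    ext x; exact Complex.add_re _ _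
  have im_add : ∀ f g, im (f + g) = im f + im g := fun f g => by
    ext x; exact Complex.add_im _ _
  have re_smul : ∀ (c : ℂ) f, re (c • f) = c.re • re f - c.im • im f := fun c f => by
    ext x; exact Complex.mul_re _ _
  have im_smul : ∀ (c : ℂ) f, im (c • f) = c.re • im f + c.im • re f := fun c f => by
    ext x; exact Complex.mul_im _ _
  refine ⟨LinearMap.mkContinuous
    { toFun := fun f => (⟨μ (re f), μ (im f)⟩ : ℂ)
      map_add' := fun f g => by
        rw [re_add, im_add, map_add, map_add]; rfl
      map_smul' := fun c f => by
        rw [re_smul, im_smul, map_add, map_sub, map_smul, map_smul, map_smul, map_smul]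
        apply Complex.ext <;> simp } 2 ?_, ?_, ?_⟩
  · intro f
    refine (Complex.norm_le_abs_re_add_abs_im _).trans ?_
    have h1 := (bound (re f)).trans (norm_re f)
    have h2 := (bound (im f)).trans (norm_im f)
    change |μ (re f)| + |μ (im f)| ≤ _
    linarith
  · intro f c hf
    have hr : re f = c.re • 1 := by
      ext x
      change (f x).re = c.re * 1
      rw [hf, mul_one]
    have hi : im f = c.im • 1 := by
      ext x
      change (f x).im = c.im * 1
      rw [hf, mul_one]
    change (⟨μ (re f), μ (im f)⟩ : ℂ) = c
    rw [hr, hi, map_smul, map_smul, h1]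
    apply Complex.ext <;> simp
  · intro a f f' hf
    have hr : re f' = leftTranslate a⁻¹ (re f) := by
      ext x
      change (f' x).re = (f (a⁻¹⁻¹ * x)).re
      rw [hf, inv_inv]
    have hi : im f' = leftTranslate a⁻¹ (im f) := by
      ext x
      change (f' x).im = (f (a⁻¹⁻¹ * x)).im
      rw [hf, inv_inv]
    change (⟨μ (re f'), μ (im f')⟩ : ℂ) = ⟨μ (re f), μ (im f)⟩
    rw [hr, hi, hinv, hinv]

end AlmostInvariant

end

noncomputable section

/-! ### Virtual diagonals in unital Banach algebras -/

section VirtualDiagonal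

variable {A : Type u} [NonUnitalNormedRing A] [NormedSpace ℂ A] [IsScalarTower ℂ A A]
  [SMulCommClass ℂ A A]

/-- For `y ∈ X`, the functional `a ⊗ b ↦ (a · D b)(y)`, as a function of `y`. -/
def derivationPairing {X : Type v} [NormedAddCommGroup X] [NormedSpace ℂ X]
    (M : BanachBimodule A X) (D : A →L[ℂ] StrongDual ℂ X) :
    X →L[ℂ] StrongDual ℂ (ProjTensor A) :=
  ProjTensor.lift.comp
    ((ContinuousLinearMap.flipₗᵢ ℂ A X ℂ).toContinuousLinearEquiv.toContinuousLinearMap.comp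
      (M.dual.left.bilinearComp (.id ℂ A) D)).flip

@[simp]
theorem derivationPairing_tmul {X : Type v} [NormedAddCommGroup X] [NormedSpace ℂ X]
    (M : BanachBimodule A X) (D : A →L[ℂ] StrongDual ℂ X) (y : X) (a b : A) :
    derivationPairing M D y (ProjTensor.tmul a b) = D b (M.right a y) := by
  simp only [derivationPairing, ContinuousLinearMap.comp_apply, ProjTensor.lift_tmul]
  rfl

@[simp]
theorem projTensor_left_tmul (a b c : A) :
    (BanachBimodule.projTensor A).left a (ProjTensor.tmul b c) = ProjTensor.tmul (a * b) c :=
  ProjTensor.left_tmul a b c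

@[simp]
theorem projTensor_right_tmul (a b c : A) :
    (BanachBimodule.projTensor A).right a (ProjTensor.tmul b c) = ProjTensor.tmul b (c * a) :=
  ProjTensor.right_tmul a b c

/-- `m` is a virtual diagonal with `π**(m) = e`, where `e` is an identity of `A`. -/
structure IsVirtualDiagonal [CompleteSpace A] (e : A)
    (m : StrongDual ℂ (StrongDual ℂ (ProjTensor A))) : Prop where
  one_mul : ∀ a, e * a = a
  mul_one : ∀ a, a * e = a
  comm : ∀ (a : A) (φ : StrongDual ℂ (ProjTensor A)),
    m (φ.comp ((BanachBimodule.projTensor A).left a)) =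
      m (φ.comp ((BanachBimodule.projTensor A).right a))
  product : ∀ φ : StrongDual ℂ A, m (φ.comp (productMorphism A)) = φ e

variable [CompleteSpace A] {e : A} {m : StrongDual ℂ (StrongDual ℂ (ProjTensor A))}

theorem IsVirtualDiagonal.isStrongPseudoAmenable (h : IsVirtualDiagonal e m) :
    IsStrongPseudoAmenable A := by
  have hl : ∀ a, (BanachBimodule.self A).dual.dual.left a (secondAdjoint (productMorphism A) m) =
      NormedSpace.inclusionInDoubleDual ℂ A a := fun a => by
    ext φ
    refine (h.product (φ.comp ((BanachBimodule.self A).left a))).trans ?_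
    simp [BanachBimodule.self, h.mul_one]
  have hr : ∀ a, (BanachBimodule.self A).dual.dual.right a (secondAdjoint (productMorphism A) m) =
      NormedSpace.inclusionInDoubleDual ℂ A a := fun a => by
    ext φ
    refine (h.product (φ.comp ((BanachBimodule.self A).right a))).trans ?_
    simp [BanachBimodule.self, h.one_mul]
  refine ⟨PUnit, inferInstance, inferInstance, inferInstance, fun _ => m, fun a => ⟨?_, ?_, ?_⟩⟩
  · have : (BanachBimodule.projTensor A).dual.dual.left a m =
        (BanachBimodule.projTensor A).dual.dual.right a m := by
      ext φ
      exact h.comm a φ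
    simp only [this, sub_self]
    exact tendsto_const_nhds
  · intro _
    rw [hl, hr]
  · simp only [hl]
    exact tendsto_const_nhds

/-- Johnson's argument: pairing the virtual diagonal with `a ⊗ b ↦ a · D b` implements `e · D`. As
`e` need not act as the identity on `X`, the rest of the derivation is handled separately. -/
theorem IsVirtualDiagonal.isApproximatelyAmenable (h : IsVirtualDiagonal e m) :
    IsApproximatelyAmenable A := by
  intro X _ _ _ M D hD
  have hD' : ∀ a b y, D (a * b) y = D b (M.right a y) + D a (M.left b y) := fun a b y =>
    congrArg (fun φ => φ y) (hD a b)
  let f : StrongDual ℂ X := m.comp (derivationPairing M D)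
  have hf : ∀ c y, f (M.right c y) - f (M.left c y) = D c (M.right e y) := by
    intro c y
    have h1 : derivationPairing M D (M.right c y) =
        (derivationPairing M D y).comp ((BanachBimodule.projTensor A).left c) :=
      ProjTensor.ext_tmul fun a b => by simp [M.right_mul]
    have h2 : (derivationPairing M D y).comp ((BanachBimodule.projTensor A).right c) =
        derivationPairing M D (M.left c y) +
          ((D c).comp (M.right.flip y)).comp (productMorphism A) :=
      ProjTensor.ext_tmul fun a b => by
        rw [add_apply]
        simp [hD', productMorphism_tmul, M.right_mul, M.left_right, add_comm]
    change m (derivationPairing M D (M.right c y)) - m (derivationPairing M D (M.left c y)) = _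
    rw [h1, h.comm, h2, map_add, h.product]
    simp
  -- Since `D c = e · D c + D e · c`, the term `D e · c` must be supplied: `-D e` gives `D e · c - c
  -- · D e`, and `e · D e` cancels the last part because `c e = c`. What remains, `e · D e · c`, is
  -- zero, as seen on applying `e` to the same identity; that is `h3`.
  refine ⟨PUnit, inferInstance, inferInstance, inferInstance,
    fun _ => f - D e + M.dual.left e (D e), fun c => ?_⟩
  suffices H : M.dual.left c (f - D e + M.dual.left e (D e)) -
      M.dual.right c (f - D e + M.dual.left e (D e)) = D c by
    simp only [H]
    exact tendsto_const_nhds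
  ext y
  change f (M.right c y) - D e (M.right c y) + D e (M.right e (M.right c y)) -
    (f (M.left c y) - D e (M.left c y) + D e (M.right e (M.left c y))) = D c y
  have h1 := hf c y
  have h2 := hD' e c y
  have h3 := hD' e c (M.right e y)
  rw [← M.right_mul, h.mul_one]
  rw [h.one_mul] at h2 h3
  rw [← M.right_mul, h.mul_one, M.left_right] at h3
  linear_combination h1 - h2 + h3

end VirtualDiagonal

/-! ### A virtual diagonal for Brandt semigroup algebras over finite index sets -/

namespace BrandtSemigroup

open SemigroupAlgebraL1

variable {G : Type u} {I : Type v}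

/-- The element `δ_{(g)_{i,j}} - δ_0`. -/
def unitEntry (g : G) (i j : I) : SemigroupAlgebraL1 (BrandtSemigroup G I) :=
  delta (entry g i j) 1 - delta zero 1

theorem delta_entry (g : G) (i j : I) :
    delta (entry g i j) 1 = unitEntry g i j + delta zero 1 := by
  simp [unitEntry]

variable [Group G]

@[simp]
theorem zero_mul (s : BrandtSemigroup G I) : zero * s = zero := by
  cases s <;> rfl

@[simp]
theorem mul_zero (s : BrandtSemigroup G I) : s * zero = zero := by
  cases s <;> rfl

@[simp]
theorem entry_mul_entry (g h : G) (i j k : I) :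
    entry g i j * entry h j k = entry (g * h) i k :=
  if_pos rfl

theorem entry_mul_entry_of_ne (g h : G) (i : I) {j k : I} (l : I) (hjk : j ≠ k) :
    entry g i j * entry h k l = zero :=
  if_neg hjk

theorem norm_unitEntry_le (g : G) (i j : I) : ‖unitEntry g i j‖ ≤ 2 := by
  refine (norm_sub_le _ _).trans ?_
  rw [norm_delta, norm_delta, norm_one]
  norm_num

@[simp]
-- Subtracting `δ_0` turns the semigroup zero into the algebra zero, so that these elements behave
-- as matrix units over `G`.
theorem unitEntry_mul_unitEntry (g h : G) (i j k : I) :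
    unitEntry g i j * unitEntry h j k = unitEntry (g * h) i k := by
  simp [unitEntry, mul_sub, sub_mul]

theorem unitEntry_mul_unitEntry_of_ne (g h : G) (i : I) {j k : I} (l : I) (hjk : j ≠ k) :
    unitEntry g i j * unitEntry h k l = 0 := by
  simp [unitEntry, mul_sub, sub_mul, entry_mul_entry_of_ne g h i l hjk]

@[simp]
theorem unitEntry_mul_delta_zero (g : G) (i j : I) :
    unitEntry g i j * delta zero 1 = 0 := by
  simp [unitEntry, sub_mul]

@[simp]
theorem delta_zero_mul_unitEntry (g : G) (i j : I) :
    delta zero 1 * unitEntry g i j = 0 := by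
  simp [unitEntry, mul_sub]

variable [Fintype I]

variable (G I) in
/-- The identity of `ℓ¹(M⁰(G, I))`, for finite `I`. -/
def identity : SemigroupAlgebraL1 (BrandtSemigroup G I) :=
  ∑ i : I, unitEntry 1 i i + delta zero 1

theorem identity_mul (a : SemigroupAlgebraL1 (BrandtSemigroup G I)) : identity G I * a = a := by
  have : ContinuousLinearMap.mul ℂ _ (identity G I) = ContinuousLinearMap.id ℂ _ := by
    refine ext_delta_one fun s => ?_
    have h0 : identity G I * delta zero 1 = delta zero 1 := by
      simp [identity, add_mul, Finset.sum_mul]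
    rcases s with _ | ⟨g, i, j⟩
    · exact h0
    · change identity G I * delta (entry g i j) 1 = delta (entry g i j) 1
      rw [delta_entry, mul_add, h0]
      congr 1
      rw [identity, add_mul, Finset.sum_mul, Finset.sum_eq_single i]
      · simp
      · exact fun k _ hk => unitEntry_mul_unitEntry_of_ne _ _ _ _ hk
      · simp
  exact congrArg (fun φ => φ a) this

theorem mul_identity (a : SemigroupAlgebraL1 (BrandtSemigroup G I)) : a * identity G I = a := by
  have : (ContinuousLinearMap.mul ℂ _).flip (identity G I) = ContinuousLinearMap.id ℂ _ := by
    refine ext_delta_one fun s => ?_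
    have h0 : delta zero 1 * identity G I = delta zero 1 := by
      simp [identity, mul_add, Finset.mul_sum]
    rcases s with _ | ⟨g, i, j⟩
    · exact h0
    · change delta (entry g i j) 1 * identity G I = delta (entry g i j) 1
      rw [delta_entry, add_mul, h0]
      congr 1
      rw [identity, mul_add, Finset.mul_sum, Finset.sum_eq_single j]
      · simp
      · exact fun k _ hk => unitEntry_mul_unitEntry_of_ne _ _ _ _ hk.symm
      · simp
  exact congrArg (fun φ => φ a) this

open ProjTensor

/-- The tensor whose average over `g` is a diagonal of `ℓ¹(M⁰(G, I))`. -/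
def diagonalTerm (o : I) (g : G) : ProjTensor (SemigroupAlgebraL1 (BrandtSemigroup G I)) :=
  ∑ i, tmul (unitEntry g i o) (unitEntry g⁻¹ o i) + tmul (delta zero 1) (delta zero 1)

theorem norm_diagonalTerm_le (o : I) (g : G) :
    ‖diagonalTerm o g‖ ≤ Fintype.card I * 4 + 1 := by
  refine (norm_add_le _ _).trans (add_le_add ((norm_sum_le _ _).trans ?_) ?_)
  · refine (Finset.sum_le_card_nsmul _ _ 4 fun i _ => ?_).trans (by simp)
    refine (norm_tmul_le _ _).trans ?_
    have := mul_le_mul (norm_unitEntry_le g i o) (norm_unitEntry_le g⁻¹ o i) (norm_nonneg _)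
      zero_le_two
    linarith
  · refine (norm_tmul_le _ _).trans ?_
    simp [norm_delta]

theorem productMorphism_diagonalTerm (o : I) (g : G) :
    productMorphism _ (diagonalTerm o g) = identity G I := by
  simp [diagonalTerm, productMorphism_tmul, identity]

theorem delta_zero_left_diagonalTerm (o : I) (g : G) :
    (BanachBimodule.projTensor _).left (delta zero 1) (diagonalTerm o g) =
      tmul (delta zero 1) (delta zero 1) := by
  simp [diagonalTerm]

theorem delta_zero_right_diagonalTerm (o : I) (g : G) :
    (BanachBimodule.projTensor _).right (delta zero 1) (diagonalTerm o g) =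
      tmul (delta zero 1) (delta zero 1) := by
  simp [diagonalTerm]

theorem unitEntry_left_diagonalTerm (o : I) (g h : G) (i j : I) :
    (BanachBimodule.projTensor _).left (unitEntry h i j) (diagonalTerm o g) =
      tmul (unitEntry (h * g) i o) (unitEntry g⁻¹ o j) := by
  rw [diagonalTerm, map_add, map_sum, Finset.sum_eq_single j]
  · simp
  · intro k _ hk
    simp [unitEntry_mul_unitEntry_of_ne _ _ _ _ hk.symm]
  · simp

/-- At `h * g` in place of `g` this is exactly the tensor of `unitEntry_left_diagonalTerm`. The two
module actions therefore differ by a left translation in `g`, which the mean does not see. -/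
theorem unitEntry_right_diagonalTerm (o : I) (g h : G) (i j : I) :
    (BanachBimodule.projTensor _).right (unitEntry h i j) (diagonalTerm o g) =
      tmul (unitEntry g i o) (unitEntry (g⁻¹ * h) o j) := by
  rw [diagonalTerm, map_add, map_sum, Finset.sum_eq_single i]
  · simp
  · intro k _ hk
    simp [unitEntry_mul_unitEntry_of_ne _ _ _ _ hk]
  · simp

theorem exists_isVirtualDiagonal [Nonempty I] (hG : IsAmenableGroup G) :
    ∃ m, IsVirtualDiagonal (identity G I) m := by
  obtain ⟨ν, hconst, hinv⟩ := hG.exists_complex_mean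
  obtain ⟨o⟩ := ‹Nonempty I›
  have bound : ∀ (φ : StrongDual ℂ (ProjTensor (SemigroupAlgebraL1 (BrandtSemigroup G I)))) (g : G),
      ‖φ (diagonalTerm o g)‖ ≤ (Fintype.card I * 4 + 1) * ‖φ‖ := fun φ g => by
    rw [mul_comm]
    exact φ.le_opNorm_of_le (norm_diagonalTerm_le o g)
  let orbit : StrongDual ℂ (ProjTensor (SemigroupAlgebraL1 (BrandtSemigroup G I))) →L[ℂ]
      lp (fun _ : G => ℂ) ∞ :=
    LinearMap.mkContinuous
      { toFun := fun φ => linftyMk (fun g => φ (diagonalTerm o g)) _ (bound φ)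
        map_add' := fun φ ψ => rfl
        map_smul' := fun c φ => rfl } (Fintype.card I * 4 + 1)
      fun φ => lp.norm_le_of_forall_le (by positivity) (bound φ)
  have orbit_apply : ∀ φ g, orbit φ g = φ (diagonalTerm o g) := fun φ g => rfl
  refine ⟨ν.comp orbit, identity_mul, mul_identity, fun a φ => ?_, fun φ => ?_⟩
  · have key : ((ν.comp orbit).comp (ContinuousLinearMap.compL ℂ _ _ _ φ)).comp
        (BanachBimodule.projTensor _).left =
        ((ν.comp orbit).comp (ContinuousLinearMap.compL ℂ _ _ _ φ)).comp
        (BanachBimodule.projTensor _).right := by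
      have h0 : ν (orbit (φ.comp ((BanachBimodule.projTensor _).left (delta zero 1)))) =
          ν (orbit (φ.comp ((BanachBimodule.projTensor _).right (delta zero 1)))) := by
        congr 1
        ext g
        rw [orbit_apply, orbit_apply, ContinuousLinearMap.comp_apply,
          ContinuousLinearMap.comp_apply, delta_zero_left_diagonalTerm,
          delta_zero_right_diagonalTerm]
      refine ext_delta_one fun s => ?_
      rcases s with _ | ⟨h, i, j⟩
      · exact h0
      · rw [delta_entry, map_add, map_add]
        refine congrArg₂ (· + ·) ?_ h0
        refine hinv h _ _ fun g => ?_
        change φ ((BanachBimodule.projTensor _).left (unitEntry h i j) (diagonalTerm o g)) =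
          φ ((BanachBimodule.projTensor _).right (unitEntry h i j) (diagonalTerm o (h * g)))
        rw [unitEntry_left_diagonalTerm, unitEntry_right_diagonalTerm]
        simp
    exact congrArg (fun φ => φ a) key
  · refine hconst _ _ fun g => ?_
    exact congrArg φ (productMorphism_diagonalTerm o g)

end BrandtSemigroup

end

noncomputable section

/-! ### Strong pseudo-amenability forces a finite index set and an amenable group -/

theorem exists_norm_apply_le {E : Type*} [NormedAddCommGroup E] [NormedSpace ℂ E]
    (m : StrongDual ℂ E) : ∃ C, 0 ≤ C ∧ ∀ x, ‖m x‖ ≤ C * ‖x‖ :=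
  ⟨‖m‖, norm_nonneg m, m.le_opNorm⟩

/-- Strong pseudo-amenability, with the module actions on the second duals written out. -/
theorem IsStrongPseudoAmenable.exists_net {A : Type u} [NonUnitalNormedRing A] [NormedSpace ℂ A]
    [IsScalarTower ℂ A A] [SMulCommClass ℂ A A] [CompleteSpace A] (H : IsStrongPseudoAmenable A) :
    ∃ (ι : Type u) (_ : Preorder ι) (_ : IsDirectedOrder ι) (_ : Nonempty ι)
      (m : ι → StrongDual ℂ (StrongDual ℂ (ProjTensor A))),
      (∀ α, ∃ C, 0 ≤ C ∧ ∀ φ, ‖m α φ‖ ≤ C * ‖φ‖) ∧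
      (∀ (a : A) (ε : ℝ), 0 < ε → ∀ᶠ α in atTop, ∀ φ : StrongDual ℂ (ProjTensor A),
        ‖m α (φ.comp ((BanachBimodule.projTensor A).left a)) -
          m α (φ.comp ((BanachBimodule.projTensor A).right a))‖ ≤ ε * ‖φ‖) ∧
      (∀ (a : A) (α : ι) (ψ : StrongDual ℂ A),
        m α ((ψ.comp ((BanachBimodule.self A).left a)).comp (productMorphism A)) =
          m α ((ψ.comp ((BanachBimodule.self A).right a)).comp (productMorphism A))) ∧
      ∀ (a : A) (ψ : StrongDual ℂ A), Tendsto
        (fun α => m α ((ψ.comp ((BanachBimodule.self A).left a)).comp (productMorphism A)))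
        atTop (𝓝 (ψ a)) := by
  obtain ⟨ι, i₁, i₂, i₃, m, hm⟩ := H
  refine ⟨ι, i₁, i₂, i₃, m,
    fun α => exists_norm_apply_le (E := StrongDual ℂ (ProjTensor A)) (m α), fun a ε hε => ?_,
    fun a α ψ => ?_, fun a ψ => ?_⟩
  · filter_upwards [Metric.tendsto_nhds.1 (hm a).1 ε hε] with α hα φ
    rw [dist_zero_right] at hα
    exact ContinuousLinearMap.le_of_opNorm_le _ hα.le φ
  · exact congrArg (fun P => P ψ) ((hm a).2.1 α)
  · exact ((ContinuousLinearMap.apply ℂ ℂ ψ).continuous.tendsto _).comp (hm a).2.2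

theorem SemigroupAlgebraL1.norm_le_of_delta {S : Type u} {Y : Type*} [NormedAddCommGroup Y]
    [NormedSpace ℂ Y] [CompleteSpace Y] {φ : SemigroupAlgebraL1 S →L[ℂ] Y} {C : ℝ} (hC : 0 ≤ C)
    (h : ∀ s, ‖φ (delta s 1)‖ ≤ C) : ‖φ‖ ≤ C := by
  have : φ = lift (fun s => φ (delta s 1)) C h := ext_delta_one fun s => by simp
  rw [this]
  exact norm_lift_le h hC

namespace BrandtSemigroup

open SemigroupAlgebraL1

variable {G : Type u} {I : Type v}

open scoped Classical in
/-- The indicator function of `{(g)_{i,j} : g ∈ G}`. -/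
def blockIndicator (i j : I) : BrandtSemigroup G I → ℂ
  | zero => 0
  | entry _ k l => if k = i ∧ l = j then 1 else 0

/-- The functional on `ℓ¹(M⁰(G, I))` that sums the coefficients of the `(g)_{i,j}`, `g ∈ G`. -/
def blockSum (i j : I) : StrongDual ℂ (SemigroupAlgebraL1 (BrandtSemigroup G I)) :=
  lift (blockIndicator i j) 1 (by
    rintro (_ | ⟨g, k, l⟩)
    · simp [blockIndicator]
    · by_cases h : k = i ∧ l = j <;> simp [blockIndicator, h])

open scoped Classical in
@[simp]
theorem blockSum_delta_entry (i j k l : I) (g : G) :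
    blockSum i j (delta (entry g k l) 1) = if k = i ∧ l = j then 1 else 0 := by
  simp [blockSum, blockIndicator]

@[simp]
theorem blockSum_delta_zero (i j : I) : blockSum i j (delta (zero : BrandtSemigroup G I) 1) = 0 := by
  simp [blockSum, blockIndicator]

/-- A point mass lies in at most one diagonal block, so the bound does not grow with `F`. -/
theorem norm_sum_blockSum_le (F : Finset I) :
    ‖∑ i ∈ F, (blockSum i i : StrongDual ℂ (SemigroupAlgebraL1 (BrandtSemigroup G I)))‖ ≤ 1 := by
  classical
  refine norm_le_of_delta zero_le_one fun s => ?_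
  rw [sum_apply]
  rcases s with _ | ⟨g, k, l⟩
  · simp
  · simp only [blockSum_delta_entry]
    by_cases h : k = l
    · subst h
      by_cases hk : k ∈ F <;> simp [hk]
    · rw [Finset.sum_eq_zero]
      · simp
      · rintro i -
        rw [if_neg]
        rintro ⟨rfl, rfl⟩
        exact h rfl

open scoped Classical in
/-- The kernel on `M⁰(G, I) × M⁰(G, I)` that is `f(g)` at `((g)_{o,j}, (h)_{j,o})` and zero
elsewhere. -/
def cornerKernel (o : I) (f : lp (fun _ : G => ℝ) ∞) :
    BrandtSemigroup G I → BrandtSemigroup G I → ℂ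
  | entry g i j, entry _ k l => if i = o ∧ j = k ∧ l = o then (f g : ℂ) else 0
  | _, _ => 0

theorem norm_cornerKernel_le (o : I) (f : lp (fun _ : G => ℝ) ∞) (s t : BrandtSemigroup G I) :
    ‖cornerKernel o f s t‖ ≤ ‖f‖ := by
  rcases s with _ | ⟨g, i, j⟩ <;> rcases t with _ | ⟨h, k, l⟩
  iterate 3 simp [cornerKernel]
  simp only [cornerKernel]
  split_ifs
  · rw [Complex.norm_real]
    exact linfty_apply_le f g
  · simp

variable [Group G]

theorem blockSum_comp_mul_left (i j k : I) (g : G) :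
    (blockSum i k).comp ((BanachBimodule.self _).left (delta (entry g i j) 1)) = blockSum j k := by
  classical
  refine ext_delta_one fun s => ?_
  change blockSum i k (delta (entry g i j) 1 * delta s 1) = _
  rcases s with _ | ⟨h, l, n⟩
  · simp
  · by_cases hl : j = l
    · subst hl; simp
    · simp [entry_mul_entry_of_ne _ _ _ _ hl, Ne.symm hl]

theorem blockSum_comp_mul_right (i j k : I) (g : G) :
    (blockSum k j).comp ((BanachBimodule.self _).right (delta (entry g i j) 1)) = blockSum k i := by
  classical
  refine ext_delta_one fun s => ?_
  change blockSum k j (delta s 1 * delta (entry g i j) 1) = _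
  rcases s with _ | ⟨h, l, n⟩
  · simp
  · by_cases hl : n = i
    · subst hl; simp
    · simp [entry_mul_entry_of_ne _ _ _ _ hl, hl]

/-- A central functional on the dual behaves like a scalar multiple of the identity matrix: all its
diagonal block sums agree. With infinitely many blocks a nonzero common value contradicts the bound
`C`, because block sums over `F` add up to a functional of norm at most one. -/
theorem finite_of_central
    (P : StrongDual ℂ (SemigroupAlgebraL1 (BrandtSemigroup G I)) → ℂ)
    (hsum : ∀ (F : Finset I) (φ : I → StrongDual ℂ (SemigroupAlgebraL1 (BrandtSemigroup G I))),
      P (∑ i ∈ F, φ i) = ∑ i ∈ F, P (φ i))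
    (C : ℝ) (hC : ∀ φ, ‖φ‖ ≤ 1 → ‖P φ‖ ≤ C)
    (hP : ∀ a (φ : StrongDual ℂ (SemigroupAlgebraL1 (BrandtSemigroup G I))), P (φ.comp ((BanachBimodule.self _).left a)) =
      P (φ.comp ((BanachBimodule.self _).right a))) (o : I) (ho : P (blockSum o o) ≠ 0) :
    Finite I := by
  by_contra hI
  rw [not_finite_iff_infinite] at hI
  have hc : ∀ i, P (blockSum i i) = P (blockSum o o) := fun i => by
    -- The matrix unit in position `(i, o)` carries block `(o, o)` to block `(i, i)`.
    have := hP (delta (entry (1 : G) i o) 1) (blockSum i o)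
    rw [blockSum_comp_mul_left, blockSum_comp_mul_right] at this
    exact this.symm
  obtain ⟨n, hn⟩ := exists_nat_gt (C / ‖P (blockSum o o)‖)
  obtain ⟨F, hF⟩ := Infinite.exists_subset_card_eq I n
  have h1 := hC _ (norm_sum_blockSum_le (G := G) F)
  rw [hsum, Finset.sum_congr rfl fun i _ => hc i, Finset.sum_const, hF, nsmul_eq_mul, norm_mul,
    Complex.norm_natCast] at h1
  rw [div_lt_iff₀ (norm_pos_iff.2 ho)] at hn
  linarith

/-- The functional on the projective tensor square with kernel `cornerKernel o f`. -/
def cornerForm (o : I) (f : lp (fun _ : G => ℝ) ∞) :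
    StrongDual ℂ (ProjTensor (SemigroupAlgebraL1 (BrandtSemigroup G I))) :=
  ProjTensor.lift (lift (fun s => lift (cornerKernel o f s) ‖f‖ (norm_cornerKernel_le o f s)) ‖f‖
    fun s => norm_lift_le (norm_cornerKernel_le o f s) (norm_nonneg f))

theorem norm_cornerForm_le (o : I) (f : lp (fun _ : G => ℝ) ∞) : ‖cornerForm o f‖ ≤ ‖f‖ :=
  (ProjTensor.norm_lift_le _).trans (norm_lift_le _ (norm_nonneg f))

@[simp]
theorem cornerForm_tmul_delta (o : I) (f : lp (fun _ : G => ℝ) ∞) (s t : BrandtSemigroup G I) :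
    cornerForm o f (ProjTensor.tmul (delta s 1) (delta t 1)) = cornerKernel o f s t := by
  simp [cornerForm]

theorem cornerForm_add (o : I) (f f' : lp (fun _ : G => ℝ) ∞) :
    cornerForm o (f + f') = cornerForm o f + cornerForm o f' := by
  classical
  refine ProjTensor.ext_delta fun s t => ?_
  rw [add_apply]
  rcases s with _ | ⟨g, i, j⟩ <;> rcases t with _ | ⟨h, k, l⟩
  iterate 3 simp [cornerKernel]
  simp only [cornerForm_tmul_delta, cornerKernel, lp.coeFn_add, Pi.add_apply]
  split_ifs <;> simp

theorem cornerForm_smul (o : I) (c : ℝ) (f : lp (fun _ : G => ℝ) ∞) :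
    cornerForm o (c • f) = (c : ℂ) • cornerForm o f := by
  classical
  refine ProjTensor.ext_delta fun s t => ?_
  rw [smul_apply]
  rcases s with _ | ⟨g, i, j⟩ <;> rcases t with _ | ⟨h, k, l⟩
  iterate 3 simp [cornerKernel]
  simp only [cornerForm_tmul_delta, cornerKernel, lp.coeFn_smul, Pi.smul_apply]
  split_ifs <;> simp

/-- This identification transfers the normalisation of `π**(m_α)` to the functional `f ↦ m_α
(cornerForm o f)` at `f = 1`. -/
theorem cornerForm_one (o : I) :
    cornerForm (G := G) o 1 = (blockSum o o).comp (productMorphism _) := by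
  classical
  refine ProjTensor.ext_delta fun s t => ?_
  rw [ContinuousLinearMap.comp_apply, productMorphism_tmul, delta_mul_delta, cornerForm_tmul_delta]
  rcases s with _ | ⟨g, i, j⟩ <;> rcases t with _ | ⟨h, k, l⟩
  iterate 3 simp [cornerKernel]
  by_cases hjk : j = k
  · subst hjk
    simp [cornerKernel]
  · simp [cornerKernel, hjk, entry_mul_entry_of_ne _ _ _ _ hjk]

theorem cornerForm_comp_left (o : I) (a : G) (f : lp (fun _ : G => ℝ) ∞) :
    (cornerForm o f).comp ((BanachBimodule.projTensor _).left (delta (entry a⁻¹ o o) 1)) =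
      cornerForm o (leftTranslate a f) := by
  classical
  refine ProjTensor.ext_delta fun s t => ?_
  rw [ContinuousLinearMap.comp_apply, projTensor_left_tmul, delta_mul_delta, mul_one,
    cornerForm_tmul_delta, cornerForm_tmul_delta]
  rcases s with _ | ⟨g, i, j⟩
  · simp [cornerKernel]
  by_cases hi : o = i
  · subst hi
    rcases t with _ | ⟨h, k, l⟩ <;> simp [cornerKernel, leftTranslate_apply]
  · rcases t with _ | ⟨h, k, l⟩ <;>
      simp [cornerKernel, Ne.symm hi, entry_mul_entry_of_ne _ _ _ _ hi]

/-- The kernel ignores the group coordinate of the second factor, so right multiplication inside the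
corner leaves it unchanged. Left multiplication translates `f`; asymptotic commutation of `m_α` thus
becomes almost invariance. -/
theorem cornerForm_comp_right (o : I) (a : G) (f : lp (fun _ : G => ℝ) ∞) :
    (cornerForm o f).comp ((BanachBimodule.projTensor _).right (delta (entry a o o) 1)) =
      cornerForm o f := by
  classical
  refine ProjTensor.ext_delta fun s t => ?_
  rw [ContinuousLinearMap.comp_apply, projTensor_right_tmul, delta_mul_delta, mul_one,
    cornerForm_tmul_delta, cornerForm_tmul_delta]
  rcases t with _ | ⟨h, k, l⟩
  · simp
  by_cases hl : l = o
  · subst hl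
    rcases s with _ | ⟨g, i, j⟩ <;> simp [cornerKernel]
  · rcases s with _ | ⟨g, i, j⟩ <;>
      simp [cornerKernel, hl, entry_mul_entry_of_ne _ _ _ _ hl]

theorem finite_and_isAmenableGroup_of_isStrongPseudoAmenable [Nonempty I]
    (H : IsStrongPseudoAmenable (SemigroupAlgebraL1 (BrandtSemigroup G I))) :
    IsAmenableGroup G ∧ Finite I := by
  obtain ⟨ι, _, _, _, m, hbound, hcomm, hcentral, hunit⟩ := H.exists_net
  obtain ⟨o⟩ := ‹Nonempty I›
  have hre : ∀ᶠ α in atTop, 1 / 2 ≤ (m α (cornerForm o 1)).re := by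
    have h := hunit (delta (entry (1 : G) o o) 1) (blockSum o o)
    simp only [blockSum_comp_mul_left, ← cornerForm_one, blockSum_delta_entry, and_self,
      if_true] at h
    exact ((Complex.continuous_re.tendsto _).comp h).eventually
      (eventually_ge_nhds (by norm_num))
  constructor
  · refine IsAmenableGroup.of_almost_invariant fun T ε hε => ?_
    obtain ⟨α, h1, h2⟩ := (hre.and ((eventually_all_finset T).2 fun a _ =>
      hcomm (delta (entry a⁻¹ o o) 1) ε hε)).exists
    obtain ⟨C, hC0, hC⟩ := hbound α
    refine ⟨LinearMap.mkContinuous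
      { toFun := fun f => (m α (cornerForm o f)).re
        map_add' := fun f f' => by rw [cornerForm_add, map_add, Complex.add_re]
        map_smul' := fun c f => by rw [cornerForm_smul, map_smul]; simp }
      C fun f => ?_, h1, fun a ha f => ?_⟩
    · refine (Complex.abs_re_le_norm _).trans ((hC _).trans ?_)
      exact mul_le_mul_of_nonneg_left (norm_cornerForm_le o f) hC0
    · have h3 := (h2 a ha (cornerForm o f)).trans
        (mul_le_mul_of_nonneg_left (norm_cornerForm_le o f) hε.le)
      rw [cornerForm_comp_left, cornerForm_comp_right] at h3
      exact (Complex.abs_re_le_norm _).trans h3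
  -- One index is enough, because `π**(m_α)` commutes exactly with the algebra and not merely in the
  -- limit.
  · obtain ⟨α, hα⟩ := hre.exists
    obtain ⟨C, hC0, hC⟩ := hbound α
    refine finite_of_central (fun ψ => m α (ψ.comp (productMorphism _))) (fun F φ => ?_)
      (C * ‖productMorphism (SemigroupAlgebraL1 (BrandtSemigroup G I))‖) (fun φ hφ => ?_)
      (fun a => hcentral a α) o fun h0 => ?_
    · rw [← map_sum]
      congr 1
      ext x
      simp
    · refine (hC _).trans (mul_le_mul_of_nonneg_left ?_ hC0)
      refine (ContinuousLinearMap.opNorm_comp_le _ _).trans ?_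
      exact mul_le_of_le_one_left (norm_nonneg _) hφ
    · rw [← cornerForm_one] at h0
      rw [h0] at hα
      norm_num at hα

end BrandtSemigroup

end

noncomputable section

/-! ### Approximate amenability forces an amenable group -/

/-- The Banach space `ℓ^∞(K)` of bounded complex functions. -/
def BoundedFun (K : Type u) : Type u := lp (fun _ : K => ℂ) ∞

namespace BoundedFun

variable {K : Type u}

instance : NormedAddCommGroup (BoundedFun K) :=
  inferInstanceAs (NormedAddCommGroup (lp (fun _ : K => ℂ) ∞))

instance : NormedSpace ℂ (BoundedFun K) :=
  inferInstanceAs (NormedSpace ℂ (lp (fun _ : K => ℂ) ∞))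

instance : CompleteSpace (BoundedFun K) :=
  inferInstanceAs (CompleteSpace (lp (fun _ : K => ℂ) ∞))

instance : FunLike (BoundedFun K) K ℂ := ⟨fun F => F.1, Subtype.val_injective⟩

@[ext]
theorem ext {F F' : BoundedFun K} (h : ∀ κ, F κ = F' κ) : F = F' :=
  DFunLike.ext F F' h

/-- A bounded function as an element of `ℓ^∞`. -/
def mk (f : K → ℂ) (C : ℝ) (hf : ∀ κ, ‖f κ‖ ≤ C) : BoundedFun K := linftyMk f C hf

@[simp]
theorem mk_apply (f : K → ℂ) (C : ℝ) (hf : ∀ κ, ‖f κ‖ ≤ C) (κ : K) : mk f C hf κ = f κ := rfl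

@[simp]
theorem zero_apply (κ : K) : (0 : BoundedFun K) κ = 0 := rfl

@[simp]
theorem add_apply (F F' : BoundedFun K) (κ : K) : (F + F') κ = F κ + F' κ := rfl

@[simp]
theorem smul_apply (c : ℂ) (F : BoundedFun K) (κ : K) : (c • F) κ = c * F κ := rfl

theorem norm_apply_le (F : BoundedFun K) (κ : K) : ‖F κ‖ ≤ ‖F‖ :=
  linfty_apply_le (α := K) (E := ℂ) F κ

theorem norm_le_of_forall_le {F : BoundedFun K} {C : ℝ} (hC : 0 ≤ C) (h : ∀ κ, ‖F κ‖ ≤ C) :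
    ‖F‖ ≤ C :=
  lp.norm_le_of_forall_le (E := fun _ : K => ℂ) hC h

/-- Evaluation at a point. -/
def eval (κ : K) : StrongDual ℂ (BoundedFun K) :=
  LinearMap.mkContinuous
    { toFun := fun F => F κ
      map_add' := fun _ _ => rfl
      map_smul' := fun _ _ => rfl } 1 fun F => by
    rw [one_mul]
    exact norm_apply_le F κ

@[simp]
theorem eval_apply (κ : K) (F : BoundedFun K) : eval κ F = F κ := rfl

theorem norm_eval_le (κ : K) : ‖eval κ‖ ≤ 1 :=
  LinearMap.mkContinuous_norm_le _ zero_le_one _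

theorem sum_apply {ι : Type*} (s : Finset ι) (F : ι → BoundedFun K) (κ : K) :
    (∑ i ∈ s, F i) κ = ∑ i ∈ s, F i κ :=
  map_sum (eval κ) F s

end BoundedFun

theorem norm_option_elim_le {K : Type u} (F : BoundedFun K) (κ : Option K) :
    ‖κ.elim 0 F‖ ≤ ‖F‖ := by
  cases κ with
  | none => simp
  | some κ => exact F.norm_apply_le κ

/-- The operator `F ↦ F ∘ σ` on `ℓ^∞(K)` for a partial map `σ`; the result is zero where `σ` is
undefined. -/
def partialComp {K : Type u} (σ : K → Option K) :
    BoundedFun K →L[ℂ] BoundedFun K :=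
  LinearMap.mkContinuous
    { toFun := fun F => BoundedFun.mk (fun κ => (σ κ).elim 0 F) ‖F‖ fun κ => norm_option_elim_le F (σ κ)
      map_add' := fun F F' => by
        ext κ
        change (σ κ).elim 0 (fun κ => F κ + F' κ) =
          (σ κ).elim 0 (fun κ => F κ) + (σ κ).elim 0 (fun κ => F' κ)
        cases σ κ <;> simp
      map_smul' := fun c F => by
        ext κ
        change (σ κ).elim 0 (fun κ => c * F κ) = c * (σ κ).elim 0 (fun κ => F κ)
        cases σ κ <;> simp }
    1 fun F => by
      rw [one_mul]
      exact BoundedFun.norm_le_of_forall_le (norm_nonneg _) fun κ => norm_option_elim_le F (σ κ)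

@[simp]
theorem partialComp_apply {K : Type u} (σ : K → Option K) (F : BoundedFun K) (κ : K) :
    partialComp σ F κ = (σ κ).elim 0 F := rfl

theorem norm_partialComp_le {K : Type u} (σ : K → Option K) : ‖partialComp σ‖ ≤ 1 := by
  refine ContinuousLinearMap.opNorm_le_bound _ zero_le_one fun F => ?_
  rw [one_mul]
  exact BoundedFun.norm_le_of_forall_le (norm_nonneg _) fun κ => norm_option_elim_le F (σ κ)

theorem norm_sub_le_two {E : Type*} [SeminormedAddCommGroup E] {x y : E} (hx : ‖x‖ ≤ 1)
    (hy : ‖y‖ ≤ 1) : ‖x - y‖ ≤ 2 :=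
  (norm_sub_le x y).trans (by linarith)

namespace BrandtSemigroup

open SemigroupAlgebraL1

variable {G : Type u} {I : Type v} [Group G]

open scoped Classical in
/-- The right action of `M⁰(G, I)` on `ℓ^∞(G × I × I)`, normalised at `1 ∈ G`. -/
def cocycleRight : BrandtSemigroup G I →
    BoundedFun (G × I × I) →L[ℂ] BoundedFun (G × I × I)
  | zero => 0
  | entry g i j =>
    partialComp (fun κ => if κ.2.1 = j then some (g * κ.1, i, κ.2.2) else none) -
      partialComp (fun κ => if κ.2.1 = j then some (g, i, κ.2.2) else none)

open scoped Classical in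
/-- The left action of `M⁰(G, I)` on `ℓ^∞(G × I × I)`, normalised at `1 ∈ G`. -/
def cocycleLeft : BrandtSemigroup G I →
    BoundedFun (G × I × I) →L[ℂ] BoundedFun (G × I × I)
  | zero => 0
  | entry _ i j =>
    partialComp (fun κ => if κ.2.2 = i then some (κ.1, κ.2.1, j) else none) -
      partialComp (fun κ => if κ.2.2 = i then some (1, κ.2.1, j) else none)

open scoped Classical in
theorem cocycleRight_apply (g : G) (i j : I) (F : BoundedFun (G × I × I)) (h : G)
    (k l : I) : cocycleRight (entry g i j) F (h, k, l) =
      if k = j then F (g * h, i, l) - F (g, i, l) else 0 := by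
  change (if k = j then some (g * h, i, l) else none).elim 0 F -
    (if k = j then some (g, i, l) else none).elim 0 F = _
  split_ifs <;> simp

open scoped Classical in
theorem cocycleLeft_apply (g : G) (i j : I) (F : BoundedFun (G × I × I)) (h : G)
    (k l : I) : cocycleLeft (entry g i j) F (h, k, l) =
      if l = i then F (h, k, j) - F (1, k, j) else 0 := by
  change (if l = i then some (h, k, j) else none).elim 0 F -
    (if l = i then some (1, k, j) else none).elim 0 F = _
  split_ifs <;> simp

theorem cocycleRight_zero_apply (F : BoundedFun (G × I × I)) :
    cocycleRight zero F = 0 := rfl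

theorem cocycleLeft_zero_apply (F : BoundedFun (G × I × I)) :
    cocycleLeft zero F = 0 := rfl

variable (G I) in
/-- The `ℓ¹(M⁰(G, I))`-bimodule `ℓ^∞(G × I × I)` with the normalised actions. -/
def cocycleModule :
    BanachBimodule (SemigroupAlgebraL1 (BrandtSemigroup G I)) (BoundedFun (G × I × I)) :=
  bimodule cocycleLeft cocycleRight 2
    (by
      rintro (_ | ⟨g, i, j⟩)
      · simp [cocycleLeft]
      · exact norm_sub_le_two (norm_partialComp_le _) (norm_partialComp_le _))
    (by
      rintro (_ | ⟨g, i, j⟩)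
      · simp [cocycleRight]
      · exact norm_sub_le_two (norm_partialComp_le _) (norm_partialComp_le _))
    (by
      rintro (_ | ⟨g, i, j⟩) (_ | ⟨h, k, l⟩) F
      iterate 3 simp [cocycleLeft_zero_apply]
      by_cases hjk : j = k
      · subst hjk
        ext ⟨a, b, c⟩
        simp [cocycleLeft_apply]
      · rw [entry_mul_entry_of_ne _ _ _ _ hjk]
        ext ⟨a, b, c⟩
        simp [cocycleLeft_apply, cocycleLeft_zero_apply, hjk])
    (by
      rintro (_ | ⟨g, i, j⟩) (_ | ⟨h, k, l⟩) F
      iterate 3 simp [cocycleRight_zero_apply]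
      by_cases hjk : j = k
      · subst hjk
        ext ⟨a, b, c⟩
        simp [cocycleRight_apply, mul_assoc]
      · rw [entry_mul_entry_of_ne _ _ _ _ hjk]
        ext ⟨a, b, c⟩
        simp [cocycleRight_apply, cocycleRight_zero_apply, Ne.symm hjk])
    (by
      rintro (_ | ⟨g, i, j⟩) (_ | ⟨h, k, l⟩) F
      iterate 3 simp [cocycleRight_zero_apply, cocycleLeft_zero_apply]
      ext ⟨a, b, c⟩
      simp only [cocycleRight_apply, cocycleLeft_apply]
      split_ifs <;> simp)

/-- The values of the canonical derivation into the dual of `cocycleModule` on `M⁰(G, I)`. -/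
def cocycle : BrandtSemigroup G I → StrongDual ℂ (BoundedFun (G × I × I))
  | zero => 0
  | entry g i j => BoundedFun.eval (g, i, j) - BoundedFun.eval (1, i, j)

theorem norm_cocycle_le (s : BrandtSemigroup G I) : ‖cocycle s‖ ≤ 2 := by
  rcases s with _ | ⟨g, i, j⟩
  · simp [cocycle]
  · exact norm_sub_le_two (BoundedFun.norm_eval_le _) (BoundedFun.norm_eval_le _)

theorem cocycle_entry_apply (g : G) (i j : I) (F : BoundedFun (G × I × I)) :
    cocycle (entry g i j) F = F (g, i, j) - F (1, i, j) := rfl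

theorem cocycleModule_dual_left (s : BrandtSemigroup G I)
    (x : StrongDual ℂ (BoundedFun (G × I × I))) (F : BoundedFun (G × I × I)) :
    (cocycleModule G I).dual.left (delta s 1) x F = x (cocycleRight s F) := by
  change x ((cocycleModule G I).right (delta s 1) F) = _
  rw [cocycleModule, bimodule_right_delta]

theorem cocycleModule_dual_right (s : BrandtSemigroup G I)
    (x : StrongDual ℂ (BoundedFun (G × I × I))) (F : BoundedFun (G × I × I)) :
    (cocycleModule G I).dual.right (delta s 1) x F = x (cocycleLeft s F) := by
  change x ((cocycleModule G I).left (delta s 1) F) = _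
  rw [cocycleModule, bimodule_left_delta]

/-- Formally `cocycle` is the commutator with the sum of the point masses at `(1, k, k)`, `k ∈ I`.
Its values annihilate functions constant in `G`; the normalised actions model the passage to the
quotient by those functions, where the implementing sum itself is not defined. -/
theorem cocycle_mul (s t : BrandtSemigroup G I) (F : BoundedFun (G × I × I)) :
    cocycle (s * t) F = cocycle t (cocycleRight s F) + cocycle s (cocycleLeft t F) := by
  rcases s with _ | ⟨g, i, j⟩ <;> rcases t with _ | ⟨h, k, l⟩
  iterate 3 simp [cocycle, cocycleRight_zero_apply, cocycleLeft_zero_apply]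
  by_cases hjk : j = k
  · subst hjk
    simp [cocycle_entry_apply, cocycleRight_apply, cocycleLeft_apply]
  · rw [entry_mul_entry_of_ne _ _ _ _ hjk]
    simp [cocycleRight_apply, cocycleLeft_apply, hjk, Ne.symm hjk, cocycle]

open scoped Classical in
/-- The function `(h, k, l) ↦ f(h) - f(1)` on the block `k = l = o`, and zero elsewhere. -/
def cornerFunction (o : I) (f : lp (fun _ : G => ℝ) ∞) : BoundedFun (G × I × I) :=
  BoundedFun.mk (fun κ => if κ.2.1 = o ∧ κ.2.2 = o then ((f κ.1 - f 1 : ℝ) : ℂ) else 0) (2 * ‖f‖)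
    (fun κ => by
      split_ifs
      · rw [Complex.norm_real, two_mul]
        exact (norm_sub_le _ _).trans (add_le_add (linfty_apply_le f _) (linfty_apply_le f _))
      · simp)

open scoped Classical in
theorem cornerFunction_apply (o : I) (f : lp (fun _ : G => ℝ) ∞) (h : G) (k l : I) :
    cornerFunction o f (h, k, l) = if k = o ∧ l = o then ((f h - f 1 : ℝ) : ℂ) else 0 := rfl

theorem norm_cornerFunction_le (o : I) (f : lp (fun _ : G => ℝ) ∞) :
    ‖cornerFunction o f‖ ≤ 2 * ‖f‖ :=
  BoundedFun.norm_le_of_forall_le (by positivity) fun κ => by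
    rw [cornerFunction, BoundedFun.mk_apply]
    split_ifs
    · rw [Complex.norm_real, two_mul]
      exact (norm_sub_le _ _).trans (add_le_add (linfty_apply_le f _) (linfty_apply_le f _))
    · simp

theorem cocycleRight_cornerFunction (o : I) (a : G) (f : lp (fun _ : G => ℝ) ∞) :
    cocycleRight (entry a⁻¹ o o) (cornerFunction o f) = cornerFunction o (leftTranslate a f) := by
  classical
  ext ⟨h, k, l⟩
  rw [cocycleRight_apply]
  simp only [cornerFunction_apply, leftTranslate_apply]
  by_cases hk : k = o <;> by_cases hl : l = o <;> simp [hk, hl]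

theorem cocycleLeft_cornerFunction (o : I) (a : G) (f : lp (fun _ : G => ℝ) ∞) :
    cocycleLeft (entry a o o) (cornerFunction o f) = cornerFunction o f := by
  classical
  ext ⟨h, k, l⟩
  rw [cocycleLeft_apply]
  simp only [cornerFunction_apply]
  by_cases hk : k = o <;> by_cases hl : l = o <;> simp [hk, hl]

/-- The functional `f ↦ f(1) - Re x(cornerFunction o f)` on `ℓ^∞(G)`. -/
def cornerMean (o : I) (x : StrongDual ℂ (BoundedFun (G × I × I))) :
    lp (fun _ : G => ℝ) ∞ →L[ℝ] ℝ :=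
  LinearMap.mkContinuous
    { toFun := fun f => f 1 - (x (cornerFunction o f)).re
      map_add' := fun f f' => by
        have : cornerFunction o (f + f') = cornerFunction o f + cornerFunction o f' := by
          ext ⟨h, k, l⟩
          simp only [BoundedFun.add_apply, cornerFunction_apply, lp.coeFn_add, Pi.add_apply]
          split_ifs
          · push_cast; ring
          · simp
        rw [this, map_add, Complex.add_re, lp.coeFn_add, Pi.add_apply]
        ring
      map_smul' := fun c f => by
        have : cornerFunction o (c • f) = (c : ℂ) • cornerFunction o f := by
          ext ⟨h, k, l⟩
          simp only [BoundedFun.smul_apply, cornerFunction_apply, lp.coeFn_smul, Pi.smul_apply, smul_eq_mul]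
          split_ifs
          · push_cast; ring
          · simp
        rw [this, map_smul, lp.coeFn_smul, Pi.smul_apply]
        simp
        ring }
    (1 + ‖x‖ * 2) fun f => by
      have h1 := linfty_apply_le f 1
      have h2 := (Complex.abs_re_le_norm _).trans (x.le_opNorm_of_le (norm_cornerFunction_le o f))
      refine (norm_sub_le _ _).trans ?_
      change ‖f 1‖ + |(x (cornerFunction o f)).re| ≤ _
      linarith

/-- If `x` nearly implements the derivation, then evaluation at `1` minus `x` is nearly invariant.
It equals `1` at the constant function `1`, because `cornerFunction o 1 = 0`. -/
theorem isAmenableGroup_of_isApproximatelyAmenable [Nonempty I]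
    (H : IsApproximatelyAmenable (SemigroupAlgebraL1 (BrandtSemigroup G I))) :
    IsAmenableGroup G := by
  classical
  obtain ⟨o⟩ := ‹Nonempty I›
  refine IsAmenableGroup.of_almost_invariant fun T ε hε => ?_
  have hD := leibniz_of_delta (cocycleModule G I) (lift cocycle 2 norm_cocycle_le) fun s t => by
    ext F
    rw [add_apply, cocycleModule_dual_left, cocycleModule_dual_right]
    simp only [lift_delta, one_smul]
    exact cocycle_mul s t F
  obtain ⟨x, hx⟩ := H.exists_almost_inner _ _ hD
    ((fun a : G => delta (entry a⁻¹ o o : BrandtSemigroup G I) 1) '' (T : Set G))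
    -- The half absorbs the factor `2` in `norm_cornerFunction_le`.
    (T.finite_toSet.image _) (half_pos hε)
  refine ⟨cornerMean o x, ?_, fun a ha f => ?_⟩
  · have : cornerFunction o (1 : lp (fun _ : G => ℝ) ∞) = 0 := by
      ext ⟨h, k, l⟩
      rw [cornerFunction_apply, BoundedFun.zero_apply]
      change (if k = o ∧ l = o then (((1 : ℝ) - 1 : ℝ) : ℂ) else 0) = 0
      simp
    change 1 / 2 ≤ (1 : ℝ) - (x (cornerFunction o 1)).re
    rw [this, map_zero]
    norm_num
  · have h1 := ContinuousLinearMap.le_of_opNorm_le _ (hx _ ⟨a, ha, rfl⟩) (cornerFunction o f)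
    rw [sub_apply, sub_apply, cocycleModule_dual_left, cocycleModule_dual_right,
      cocycleRight_cornerFunction, cocycleLeft_cornerFunction, lift_delta, one_smul,
      cocycle_entry_apply, cornerFunction_apply, cornerFunction_apply] at h1
    have h2 := h1.trans (mul_le_mul_of_nonneg_left (norm_cornerFunction_le o f) (half_pos hε).le)
    have h3 := (Complex.abs_re_le_norm _).trans h2
    have h4 : ε / 2 * (2 * ‖f‖) = ε * ‖f‖ := by ring
    rw [h4] at h3
    simp only [and_self, if_true, sub_self, Complex.ofReal_zero, sub_zero, Complex.sub_re,
      Complex.ofReal_re] at h3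
    change |(f (a⁻¹ * 1) - (x (cornerFunction o (leftTranslate a f))).re) -
      (f 1 - (x (cornerFunction o f)).re)| ≤ _
    rw [mul_one]
    have key : ∀ p q r t b : ℝ, |p - q - (r - t)| ≤ b → |(r - p) - (t - q)| ≤ b :=
      fun p q r t b h => by
        rw [abs_sub_comm]
        convert h using 2
        ring
    exact key _ _ _ _ _ h3

end BrandtSemigroup

end

noncomputable section

/-! ### Approximate amenability forces a finite index set -/

namespace BrandtSemigroup

open SemigroupAlgebraL1

/-- Pairs of elements of `I` with a point at infinity adjoined. -/
abbrev PointedPair (I : Type v) : Type (max u v) := ULift.{u} (Option I × Option I)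

variable {G : Type u} {I : Type v}

open scoped Classical in
/-- The right action of `M⁰(G, I)` on bounded functions on pairs that comes from
`(g)_{i,j} · j = i`, `(g)_{i,j} · ∞ = i`; the values at `(∞, ∞)` are discarded. -/
def pairRight : BrandtSemigroup G I →
    BoundedFun (PointedPair.{u} I) →L[ℂ] BoundedFun (PointedPair.{u} I)
  | zero => 0
  | entry _ i j => partialComp fun κ =>
      if κ.down ≠ (none, none) ∧ (κ.down.1 = none ∨ κ.down.1 = some j) then
        some ⟨(some i, κ.down.2)⟩ else none

open scoped Classical in
/-- The left action of `M⁰(G, I)` on bounded functions on pairs that comes from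
`i · (g)_{i,j} = j`, `∞ · (g)_{i,j} = j`; the values at `(∞, ∞)` are discarded. -/
def pairLeft : BrandtSemigroup G I →
    BoundedFun (PointedPair.{u} I) →L[ℂ] BoundedFun (PointedPair.{u} I)
  | zero => 0
  | entry _ i j => partialComp fun κ =>
      if κ.down ≠ (none, none) ∧ (κ.down.2 = none ∨ κ.down.2 = some i) then
        some ⟨(κ.down.1, some j)⟩ else none

open scoped Classical in
theorem pairRight_apply (g : G) (i j : I) (F : BoundedFun (PointedPair.{u} I))
    (p q : Option I) : pairRight (entry g i j) F ⟨(p, q)⟩ =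
      if (p, q) ≠ (none, none) ∧ (p = none ∨ p = some j) then F ⟨(some i, q)⟩ else 0 := by
  change (if (p, q) ≠ (none, none) ∧ (p = none ∨ p = some j) then _ else _ : Option _).elim 0 F = _
  split_ifs <;> simp

open scoped Classical in
theorem pairLeft_apply (g : G) (i j : I) (F : BoundedFun (PointedPair.{u} I))
    (p q : Option I) : pairLeft (entry g i j) F ⟨(p, q)⟩ =
      if (p, q) ≠ (none, none) ∧ (q = none ∨ q = some i) then F ⟨(p, some j)⟩ else 0 := by
  change (if (p, q) ≠ (none, none) ∧ (q = none ∨ q = some i) then _ else _ : Option _).elim 0 F = _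
  split_ifs <;> simp

theorem pairRight_zero_apply (F : BoundedFun (PointedPair.{u} I)) :
    pairRight (zero : BrandtSemigroup G I) F = 0 := rfl

theorem pairLeft_zero_apply (F : BoundedFun (PointedPair.{u} I)) :
    pairLeft (zero : BrandtSemigroup G I) F = 0 := rfl

/-- The values on `M⁰(G, I)` of the derivation `a ↦ a ⊗ ∞ - ∞ ⊗ a`. -/
def pairCocycle : BrandtSemigroup G I → StrongDual ℂ (BoundedFun (PointedPair.{u} I))
  | zero => 0
  | entry _ i j => BoundedFun.eval ⟨(some i, none)⟩ - BoundedFun.eval ⟨(none, some j)⟩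

theorem norm_pairCocycle_le (s : BrandtSemigroup G I) : ‖pairCocycle s‖ ≤ 2 := by
  rcases s with _ | ⟨g, i, j⟩
  · simp [pairCocycle]
  · exact norm_sub_le_two (BoundedFun.norm_eval_le _) (BoundedFun.norm_eval_le _)

theorem pairCocycle_entry_apply (g : G) (i j : I) (F : BoundedFun (PointedPair.{u} I)) :
    pairCocycle (entry g i j) F = F ⟨(some i, none)⟩ - F ⟨(none, some j)⟩ := rfl

variable (G) in
/-- The sum of the idempotents `(1)_{i,i}`, `i ∈ T`. -/
def diagonalSum [One G] (T : Finset I) : SemigroupAlgebraL1 (BrandtSemigroup G I) :=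
  ∑ i ∈ T, delta (entry 1 i i) 1

theorem norm_diagonalSum_le [One G] (T : Finset I) : ‖diagonalSum G T‖ ≤ T.card := by
  refine (norm_sum_le _ _).trans ?_
  simp [norm_delta]

variable [Group G]

variable (G I) in
/-- The `ℓ¹(M⁰(G, I))`-bimodule of bounded functions on pairs. -/
def pairModule : BanachBimodule (SemigroupAlgebraL1 (BrandtSemigroup G I))
    (BoundedFun (PointedPair.{u} I)) :=
  bimodule pairLeft pairRight 1
    (by
      rintro (_ | ⟨g, i, j⟩)
      · simp [pairLeft]
      · exact norm_partialComp_le _)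
    (by
      rintro (_ | ⟨g, i, j⟩)
      · simp [pairRight]
      · exact norm_partialComp_le _)
    (by
      rintro (_ | ⟨g, i, j⟩) (_ | ⟨h, k, l⟩) F
      iterate 3 simp [pairLeft_zero_apply]
      by_cases hjk : j = k
      · subst hjk
        ext ⟨p, q⟩
        simp [pairLeft_apply]
      · rw [entry_mul_entry_of_ne _ _ _ _ hjk]
        ext ⟨p, q⟩
        simp [pairLeft_apply, pairLeft_zero_apply, hjk])
    (by
      rintro (_ | ⟨g, i, j⟩) (_ | ⟨h, k, l⟩) F
      iterate 3 simp [pairRight_zero_apply]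
      by_cases hjk : j = k
      · subst hjk
        ext ⟨p, q⟩
        simp [pairRight_apply]
      · rw [entry_mul_entry_of_ne _ _ _ _ hjk]
        ext ⟨p, q⟩
        simp [pairRight_apply, pairRight_zero_apply, Ne.symm hjk])
    (by
      rintro (_ | ⟨g, i, j⟩) (_ | ⟨h, k, l⟩) F
      iterate 3 simp [pairRight_zero_apply, pairLeft_zero_apply]
      ext ⟨p, q⟩
      simp only [pairRight_apply, pairLeft_apply]
      by_cases hpq : (p, q) = (none, none)
      · simp [hpq]
      · have h1 : (p, some j) ≠ (none, none) := by simp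
        have h2 : (some k, q) ≠ (none, none) := by simp
        split_ifs <;> tauto)

/-- This is the commutator with the point mass at `(∞, ∞)`. Since the actions discard that point,
the derivation is not visibly inner, yet the Leibniz rule only involves the remaining pairs. -/
theorem pairCocycle_mul (s t : BrandtSemigroup G I)
    (F : BoundedFun (PointedPair.{u} I)) :
    pairCocycle (s * t) F = pairCocycle t (pairRight s F) + pairCocycle s (pairLeft t F) := by
  rcases s with _ | ⟨g, i, j⟩ <;> rcases t with _ | ⟨h, k, l⟩
  iterate 3 simp [pairCocycle, pairRight_zero_apply, pairLeft_zero_apply]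
  by_cases hjk : j = k
  · subst hjk
    simp [pairCocycle_entry_apply, pairRight_apply, pairLeft_apply]
  · rw [entry_mul_entry_of_ne _ _ _ _ hjk]
    simp [pairRight_apply, pairLeft_apply, hjk, Ne.symm hjk, pairCocycle]

theorem exists_almost_inner_pairCocycle
    (H : IsApproximatelyAmenable (SemigroupAlgebraL1 (BrandtSemigroup G I)))
    (T : Set (SemigroupAlgebraL1 (BrandtSemigroup G I))) (hT : T.Finite) {ε : ℝ} (hε : 0 < ε) :
    ∃ x : StrongDual ℂ (BoundedFun (PointedPair.{u} I)), ∀ a ∈ T, ∀ F,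
      ‖x ((pairModule G I).right a F) - x ((pairModule G I).left a F) -
        lift pairCocycle 2 norm_pairCocycle_le a F‖ ≤ ε * ‖F‖ := by
  have hD := leibniz_of_delta (pairModule G I) (lift pairCocycle 2 norm_pairCocycle_le)
    fun s t => by
      ext F
      simp only [lift_delta, one_smul]
      refine (pairCocycle_mul s t F).trans ?_
      change _ = pairCocycle t ((pairModule G I).right (delta s 1) F) +
        pairCocycle s ((pairModule G I).left (delta t 1) F)
      rw [pairModule, bimodule_right_delta, bimodule_left_delta]
  obtain ⟨x, hx⟩ := H.exists_almost_inner _ _ hD T hT hε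
  exact ⟨x, fun a ha F => ContinuousLinearMap.le_of_opNorm_le _ (hx a ha) F⟩

open scoped Classical in
/-- The indicator function of `P × Q`. -/
def boxIndicator (P Q : Finset (Option I)) : BoundedFun (PointedPair.{u} I) :=
  BoundedFun.mk (fun κ => if κ.down.1 ∈ P ∧ κ.down.2 ∈ Q then 1 else 0) 1
    (fun κ => by split_ifs <;> simp)

end BrandtSemigroup

end

/-! ### Weighted sums over growing blocks, and a derivation that is not almost inner -/

noncomputable section

/-- No sequence that starts near `1` and tends to zero has steps this small. -/
theorem false_of_small_steps {h : ℕ → ℂ} {C : ℝ} (h0 : ‖h 0 - 1‖ ≤ 1 / 10)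
    (hstep : ∀ n, ‖h n - h (n + 1)‖ ≤ 9 / 40 * (1 / 2) ^ n)
    (hlim : ∀ n, ‖h n‖ ≤ C * (1 / 4) ^ n) : False := by
  have key : ∀ n, ‖h 0 - h n‖ ≤ 9 / 20 * (1 - (1 / 2) ^ n) := by
    intro n
    induction n with
    | zero => simp
    | succ n ih =>
      have : h 0 - h (n + 1) = (h 0 - h n) + (h n - h (n + 1)) := by ring
      rw [this]
      refine (norm_add_le _ _).trans ((add_le_add ih (hstep n)).trans (le_of_eq ?_))
      rw [pow_succ]
      ring
  have hC : Tendsto (fun n : ℕ => C * (1 / 4 : ℝ) ^ n) atTop (𝓝 0) := by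
    simpa using (tendsto_pow_atTop_nhds_zero_of_lt_one (by norm_num : (0 : ℝ) ≤ 1 / 4)
      (by norm_num)).const_mul C
  obtain ⟨n, hn⟩ := (hC.eventually (gt_mem_nhds (by norm_num : (0 : ℝ) < 1 / 10))).exists
  have h1 : (1 : ℂ) = -(h 0 - 1) + (h 0 - h n) + h n := by ring
  have h2 : (1 : ℝ) ≤ ‖h 0 - 1‖ + ‖h 0 - h n‖ + ‖h n‖ := by
    calc (1 : ℝ) = ‖(1 : ℂ)‖ := by simp
      _ = ‖-(h 0 - 1) + (h 0 - h n) + h n‖ := by rw [← h1]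
      _ ≤ ‖-(h 0 - 1)‖ + ‖h 0 - h n‖ + ‖h n‖ := norm_add₃_le
      _ = _ := by rw [norm_neg]
  have h3 : (0 : ℝ) < (1 / 2) ^ n := by positivity
  -- The three distances are at most `1/10`, `9/20` and `1/10`, with sum less than `1`.
  linarith [key n, hlim n]

/-- The bound of `norm_div_sub_div_le` at consecutive indices. Weights `8⁻ⁿ` against blocks of size
`4ⁿ` make it geometric with ratio `1/2`. -/
theorem eight_pow_div_four_pow (n : ℕ) :
    ((8 : ℝ) ^ n + 8 ^ (n + 1)) / 10 / (4 ^ n * 4 ^ (n + 1)) = 9 / 40 * (1 / 2) ^ n := by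
  have h8 : (8 : ℝ) ^ n = 2 ^ n * 4 ^ n := by rw [← mul_pow]; norm_num
  have h4 : (4 : ℝ) ^ n = 2 ^ n * 2 ^ n := by rw [← mul_pow]; norm_num
  rw [pow_succ, pow_succ, h8, h4, one_div, inv_pow]
  field_simp
  norm_num

theorem norm_le_of_norm_eighth_pow_mul_le {m : ℕ} {z : ℂ} (h : ‖(1 / 8 : ℂ) ^ m * z‖ ≤ 1 / 10) :
    ‖z‖ ≤ 8 ^ m / 10 := by
  have h8 : ‖(1 / 8 : ℂ)‖ = 1 / 8 := by norm_num
  rw [norm_mul, norm_pow, h8, one_div, inv_pow, inv_mul_le_iff₀ (by positivity)] at h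
  linarith

/-- Here `z` is the unknown value on a box. Subtracting eliminates it and compares a row average
with a column average. -/
theorem norm_div_sub_div_le {m n : ℕ} {z p q : ℂ} (hp : ‖z + 4 ^ n * p‖ ≤ 8 ^ n / 10)
    (hq : ‖z + 4 ^ m * q‖ ≤ 8 ^ m / 10) :
    ‖p / 4 ^ m - q / 4 ^ n‖ ≤ (8 ^ m + 8 ^ n) / 10 / (4 ^ m * 4 ^ n) := by
  have h1 : (4 : ℂ) ^ m * 4 ^ n * (p / 4 ^ m - q / 4 ^ n) =
      (z + 4 ^ n * p) - (z + 4 ^ m * q) := by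
    field_simp
    ring
  have h2 : ‖(4 : ℂ) ^ m * 4 ^ n * (p / 4 ^ m - q / 4 ^ n)‖ =
      4 ^ m * 4 ^ n * ‖p / 4 ^ m - q / 4 ^ n‖ := by
    rw [norm_mul, norm_mul, norm_pow, norm_pow]
    norm_num
  rw [le_div_iff₀ (by positivity), mul_comm, ← h2, h1]
  refine (norm_sub_le _ _).trans ?_
  linarith

/-- Elements `z n` of norm at most `4 ^ n`, acting on vectors `box m n`, `row m` and `col n` of norm
at most one as diagonal blocks of size `4 ^ n` act on indicator functions of products of blocks,
and a map `D` that behaves on them like the derivation `a ↦ a ⊗ ∞ - ∞ ⊗ a`. -/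
structure BlockSystem (A X : Type*) [NormedAddCommGroup A] [NormedSpace ℂ A]
    [NormedAddCommGroup X] [NormedSpace ℂ X] (L R : A →L[ℂ] X →L[ℂ] X)
    (D : A →L[ℂ] StrongDual ℂ X) where
  z : ℕ → A
  box : ℕ → ℕ → X
  row : ℕ → X
  col : ℕ → X
  norm_z : ∀ n, ‖z n‖ ≤ 4 ^ n
  norm_row : ∀ n, ‖row n‖ ≤ 1
  norm_col : ∀ n, ‖col n‖ ≤ 1
  norm_box : ∀ m n, ‖box m n‖ ≤ 1
  right_box : ∀ m n, R (z m) (box m n) = box m n + (4 ^ m : ℂ) • col n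
  right_box_of_ne : ∀ k m n, k ≠ m → R (z k) (box m n) = 0
  left_box : ∀ m n, L (z n) (box m n) = box m n + (4 ^ n : ℂ) • row m
  left_box_of_ne : ∀ k m n, k ≠ n → L (z k) (box m n) = 0
  right_row : ∀ m, R (z m) (row m) = row m
  right_row_of_ne : ∀ k m, k ≠ m → R (z k) (row m) = 0
  left_row : ∀ k m, L (z k) (row m) = 0
  deriv_box : ∀ k m n, D (z k) (box m n) = 0
  deriv_row : D (z 0) (row 0) = 1
  deriv_row_of_ne : ∀ k m, k ≠ m → D (z k) (row m) = 0

namespace BlockSystem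

variable {A X : Type*} [NormedAddCommGroup A] [NormedSpace ℂ A] [CompleteSpace A]
    [NormedAddCommGroup X] [NormedSpace ℂ X] {L R : A →L[ℂ] X →L[ℂ] X}
    {D : A →L[ℂ] StrongDual ℂ X} (B : BlockSystem A X L R D) {w : ℕ → ℂ}

/-- The element `∑ₙ wₙ zₙ`. -/
def weightedSum (w : ℕ → ℂ) : A := ∑' n, w n • B.z n

theorem summable_weightedSum (hw : ∀ n, ‖w n‖ ≤ (1 / 8) ^ n) : Summable fun n => w n • B.z n := by
  refine Summable.of_norm_bounded (g := fun n => (1 / 2 : ℝ) ^ n)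
    (summable_geometric_of_lt_one (by norm_num) (by norm_num)) fun n => ?_
  rw [norm_smul]
  refine (mul_le_mul (hw n) (B.norm_z n) (norm_nonneg _) (by positivity)).trans ?_
  rw [← mul_pow]
  norm_num

theorem map_weightedSum_of_single (hw : ∀ n, ‖w n‖ ≤ (1 / 8) ^ n) {Y : Type*}
    [NormedAddCommGroup Y] [NormedSpace ℂ Y] (φ : A →L[ℂ] Y) (m : ℕ)
    (hφ : ∀ n, n ≠ m → φ (B.z n) = 0) : φ (B.weightedSum w) = w m • φ (B.z m) := by
  rw [weightedSum, φ.map_tsum (B.summable_weightedSum hw), tsum_eq_single m]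
  · rw [map_smul]
  · intro n hn
    rw [map_smul, hφ n hn, smul_zero]

theorem map_weightedSum_eq_zero (hw : ∀ n, ‖w n‖ ≤ (1 / 8) ^ n) {Y : Type*}
    [NormedAddCommGroup Y] [NormedSpace ℂ Y] (φ : A →L[ℂ] Y) (hφ : ∀ n, φ (B.z n) = 0) :
    φ (B.weightedSum w) = 0 := by
  rw [B.map_weightedSum_of_single hw φ 0 fun n _ => hφ n, hφ, smul_zero]

theorem deriv_weightedSum_box (hw : ∀ n, ‖w n‖ ≤ (1 / 8) ^ n) (m n : ℕ) :
    D (B.weightedSum w) (B.box m n) = 0 :=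
  B.map_weightedSum_eq_zero hw (D.flip (B.box m n)) fun k => B.deriv_box k m n

theorem deriv_weightedSum_row (hw : ∀ n, ‖w n‖ ≤ (1 / 8) ^ n) :
    D (B.weightedSum w) (B.row 0) = w 0 := by
  refine (B.map_weightedSum_of_single hw (D.flip (B.row 0)) 0
    fun k hk => B.deriv_row_of_ne k 0 hk).trans ?_
  rw [ContinuousLinearMap.flip_apply, B.deriv_row, smul_eq_mul, mul_one]

theorem left_weightedSum_row (hw : ∀ n, ‖w n‖ ≤ (1 / 8) ^ n) (m : ℕ) :
    L (B.weightedSum w) (B.row m) = 0 :=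
  B.map_weightedSum_eq_zero hw (L.flip (B.row m)) fun k => B.left_row k m

theorem right_weightedSum_row (hw : ∀ n, ‖w n‖ ≤ (1 / 8) ^ n) (m : ℕ) :
    R (B.weightedSum w) (B.row m) = w m • B.row m := by
  refine (B.map_weightedSum_of_single hw (R.flip (B.row m)) m
    fun k hk => B.right_row_of_ne k m hk).trans ?_
  rw [ContinuousLinearMap.flip_apply, B.right_row]

theorem right_weightedSum_box (hw : ∀ n, ‖w n‖ ≤ (1 / 8) ^ n) (m n : ℕ) :
    R (B.weightedSum w) (B.box m n) = w m • (B.box m n + (4 ^ m : ℂ) • B.col n) := by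
  refine (B.map_weightedSum_of_single hw (R.flip (B.box m n)) m
    fun k hk => B.right_box_of_ne k m n hk).trans ?_
  rw [ContinuousLinearMap.flip_apply, B.right_box]

theorem left_weightedSum_box (hw : ∀ n, ‖w n‖ ≤ (1 / 8) ^ n) (m n : ℕ) :
    L (B.weightedSum w) (B.box m n) = w n • (B.box m n + (4 ^ n : ℂ) • B.row m) := by
  refine (B.map_weightedSum_of_single hw (L.flip (B.box m n)) n
    fun k hk => B.left_box_of_ne k m n hk).trans ?_
  rw [ContinuousLinearMap.flip_apply, B.left_box]

variable {x : StrongDual ℂ X}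

/-- The derivation vanishes on boxes and `w n = 0` removes the left action, so only the right action
of the `m`-th block survives; dividing by its weight gives the factor `8 ^ m`. -/
theorem norm_box_add_col_le (hw : ∀ n, ‖w n‖ ≤ (1 / 8) ^ n)
    (hx : ∀ y, ‖x (R (B.weightedSum w) y) - x (L (B.weightedSum w) y) - D (B.weightedSum w) y‖ ≤
      1 / 10 * ‖y‖) {m n : ℕ} (hm : w m = (1 / 8) ^ m) (hn : w n = 0) :
    ‖x (B.box m n) + 4 ^ m * x (B.col n)‖ ≤ 8 ^ m / 10 := by
  have h := (hx (B.box m n)).trans (mul_le_of_le_one_right (by norm_num) (B.norm_box m n))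
  rw [B.deriv_weightedSum_box hw, B.right_weightedSum_box hw, B.left_weightedSum_box hw, hn, hm,
    zero_smul, map_zero, sub_zero, sub_zero, map_smul, map_add, map_smul, smul_eq_mul,
    smul_eq_mul] at h
  exact norm_le_of_norm_eighth_pow_mul_le h

theorem norm_box_add_row_le (hw : ∀ n, ‖w n‖ ≤ (1 / 8) ^ n)
    (hx : ∀ y, ‖x (R (B.weightedSum w) y) - x (L (B.weightedSum w) y) - D (B.weightedSum w) y‖ ≤
      1 / 10 * ‖y‖) {m n : ℕ} (hm : w m = 0) (hn : w n = (1 / 8) ^ n) :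
    ‖x (B.box m n) + 4 ^ n * x (B.row m)‖ ≤ 8 ^ n / 10 := by
  have h := (hx (B.box m n)).trans (mul_le_of_le_one_right (by norm_num) (B.norm_box m n))
  rw [B.deriv_weightedSum_box hw, B.right_weightedSum_box hw, B.left_weightedSum_box hw, hn, hm,
    zero_smul, map_zero, sub_zero, zero_sub, norm_neg, map_smul, map_add, map_smul, smul_eq_mul,
    smul_eq_mul] at h
  exact norm_le_of_norm_eighth_pow_mul_le h

theorem norm_row_zero_sub_one_le (hw : ∀ n, ‖w n‖ ≤ (1 / 8) ^ n)
    (hx : ∀ y, ‖x (R (B.weightedSum w) y) - x (L (B.weightedSum w) y) - D (B.weightedSum w) y‖ ≤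
      1 / 10 * ‖y‖) (h0 : w 0 = 1) : ‖x (B.row 0) - 1‖ ≤ 1 / 10 := by
  have h := (hx (B.row 0)).trans (mul_le_of_le_one_right (by norm_num) (B.norm_row 0))
  rwa [B.deriv_weightedSum_row hw, B.right_weightedSum_row hw, B.left_weightedSum_row hw, h0,
    one_smul, map_zero, sub_zero] at h

/-- The derivation of a block system is not approximable by inner ones. -/
theorem not_almost_inner (B : BlockSystem A X L R D)
    (H : ∀ T : Set A, T.Finite → ∃ x : StrongDual ℂ X, ∀ a ∈ T, ∀ y,
      ‖x (R a y) - x (L a y) - D a y‖ ≤ 1 / 10 * ‖y‖) : False := by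
  -- Splitting by parity: on `box m n` with `m` even and `n` odd, the even sum acts only from the
  -- right and the odd sum only from the left.
  let we : ℕ → ℂ := fun n => if Even n then (1 / 8) ^ n else 0
  let wo : ℕ → ℂ := fun n => if Even n then 0 else (1 / 8) ^ n
  have hwe : ∀ n, ‖we n‖ ≤ (1 / 8) ^ n := fun n => by
    by_cases hn : Even n <;> simp [we, hn]
  have hwo : ∀ n, ‖wo n‖ ≤ (1 / 8) ^ n := fun n => by
    by_cases hn : Even n <;> simp [wo, hn]
  obtain ⟨x, hx⟩ := H {B.weightedSum we, B.weightedSum wo} (Set.toFinite _)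
  have hxe := hx _ (Set.mem_insert _ _)
  have hxo := hx _ (Set.mem_insert_of_mem _ rfl)
  have hbound : ∀ (n : ℕ) (y : X), ‖y‖ ≤ 1 → ‖x y / 4 ^ n‖ ≤ ‖x‖ * (1 / 4) ^ n := fun n y hy => by
    have h4 : ‖(4 : ℂ)‖ = 4 := by norm_num
    have hxy : ‖x y‖ ≤ ‖x‖ := (x.le_opNorm_of_le hy).trans (mul_one _).le
    rw [norm_div, norm_pow, one_div, inv_pow, ← div_eq_mul_inv, h4]
    gcongr
  have hstep : ∀ m n, Even m → ¬ Even n → ‖x (B.row m) / 4 ^ m - x (B.col n) / 4 ^ n‖ ≤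
      (8 ^ m + 8 ^ n) / 10 / (4 ^ m * 4 ^ n) := fun m n hm hn =>
    norm_div_sub_div_le (B.norm_box_add_row_le hwo hxo (if_pos hm) (if_neg hn))
      (B.norm_box_add_col_le hwe hxe (if_pos hm) (if_neg hn))
  -- Averages of `x` over the blocks, alternately along rows and columns, since the comparison in
  -- `hstep` links an even row to an odd column.
  refine false_of_small_steps (C := ‖x‖)
    (h := fun n => if Even n then x (B.row n) / 4 ^ n else x (B.col n) / 4 ^ n) ?_ ?_ ?_
  · have h := B.norm_row_zero_sub_one_le hwe hxe (by simp [we])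
    simpa using h
  · intro n
    rw [← eight_pow_div_four_pow]
    by_cases hn : Even n
    · have hn' : ¬ Even (n + 1) := by simpa [Nat.even_add_one] using hn
      simp only [if_pos hn, if_neg hn']
      exact hstep n (n + 1) hn hn'
    · have hn' : Even (n + 1) := by simpa [Nat.even_add_one] using hn
      simp only [if_pos hn', if_neg hn]
      rw [norm_sub_rev, add_comm ((8 : ℝ) ^ n), mul_comm ((4 : ℝ) ^ n)]
      exact hstep (n + 1) n hn' hn
  · intro n
    by_cases hn : Even n
    · simp only [if_pos hn]
      exact hbound n _ (B.norm_row n)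
    · simp only [if_neg hn]
      exact hbound n _ (B.norm_col n)

end BlockSystem

theorem exists_disjoint_blocks (I : Type v) [Infinite I] :
    ∃ T : ℕ → Finset I, (∀ n, (T n).card = 4 ^ n) ∧ ∀ m n, m ≠ n → Disjoint (T m) (T n) := by
  let e : (Σ n : ℕ, Fin (4 ^ n)) ↪ I :=
    ⟨fun p => Infinite.natEmbedding I (Encodable.encode p),
      (Infinite.natEmbedding I).injective.comp Encodable.encode_injective⟩
  refine ⟨fun n => Finset.univ.map ((Function.Embedding.sigmaMk n).trans e), fun n => by simp,
    fun m n hmn => Finset.disjoint_left.2 fun i hi hj => ?_⟩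
  obtain ⟨r, -, rfl⟩ := Finset.mem_map.1 hi
  obtain ⟨s, -, hs⟩ := Finset.mem_map.1 hj
  exact hmn (congrArg Sigma.fst (e.injective hs)).symm

/-! ### The block system of indicator functions on pairs -/

namespace BrandtSemigroup

open SemigroupAlgebraL1

variable {G : Type u} {I : Type v}

theorem norm_boxIndicator_le (P Q : Finset (Option I)) : ‖boxIndicator.{u} P Q‖ ≤ 1 :=
  BoundedFun.norm_le_of_forall_le zero_le_one fun κ => by
    rw [boxIndicator, BoundedFun.mk_apply]
    split_ifs <;> simp

open scoped Classical in
theorem boxIndicator_apply (P Q : Finset (Option I)) (p q : Option I) :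
    boxIndicator.{u} P Q ⟨(p, q)⟩ = if p ∈ P ∧ q ∈ Q then 1 else 0 := rfl

variable [Group G]

theorem right_diagonalSum (T : Finset I) (F : BoundedFun (PointedPair.{u} I))
    (κ : PointedPair.{u} I) : (pairModule G I).right (diagonalSum G T) F κ =
      ∑ i ∈ T, pairRight (entry (1 : G) i i) F κ := by
  rw [diagonalSum, map_sum, sum_apply, BoundedFun.sum_apply]
  simp only [pairModule, bimodule_right_delta]

theorem left_diagonalSum (T : Finset I) (F : BoundedFun (PointedPair.{u} I))
    (κ : PointedPair.{u} I) : (pairModule G I).left (diagonalSum G T) F κ =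
      ∑ i ∈ T, pairLeft (entry (1 : G) i i) F κ := by
  rw [diagonalSum, map_sum, sum_apply, BoundedFun.sum_apply]
  simp only [pairModule, bimodule_left_delta]

theorem right_diagonalSum_of_disjoint {T U : Finset I} (h : Disjoint T U)
    (Q : Finset (Option I)) :
    (pairModule G I).right (diagonalSum G T) (boxIndicator (U.map .some) Q) = 0 := by
  ext ⟨p, q⟩
  rw [right_diagonalSum]
  refine Finset.sum_eq_zero fun i hi => ?_
  have : i ∉ U := Finset.disjoint_left.1 h hi
  simp [pairRight_apply, boxIndicator_apply, this]

theorem left_diagonalSum_of_disjoint {T U : Finset I} (h : Disjoint T U)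
    (P : Finset (Option I)) :
    (pairModule G I).left (diagonalSum G T) (boxIndicator P (U.map .some)) = 0 := by
  ext ⟨p, q⟩
  rw [left_diagonalSum]
  refine Finset.sum_eq_zero fun i hi => ?_
  have : i ∉ U := Finset.disjoint_left.1 h hi
  simp [pairLeft_apply, boxIndicator_apply, this]

theorem left_diagonalSum_none (T : Finset I) (P : Finset (Option I)) :
    (pairModule G I).left (diagonalSum G T) (boxIndicator P {none}) = 0 := by
  ext ⟨p, q⟩
  rw [left_diagonalSum]
  exact Finset.sum_eq_zero fun i hi => by simp [pairLeft_apply, boxIndicator_apply]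

/-- Each idempotent `(1)_{i,i}` fixes `i` and also sends `∞` to `i`. At a point of `T` only one of
them contributes, while at `∞` all of them do, whence the factor `T.card`. -/
theorem right_diagonalSum_self (T U : Finset I) :
    (pairModule G I).right (diagonalSum G T) (boxIndicator (T.map .some) (U.map .some)) =
      boxIndicator (T.map .some) (U.map .some) +
        (T.card : ℂ) • boxIndicator {none} (U.map .some) := by
  classical
  ext ⟨p, q⟩
  rw [right_diagonalSum, BoundedFun.add_apply, BoundedFun.smul_apply]
  rcases q with _ | q
  · simp [pairRight_apply, boxIndicator_apply]
  by_cases hq : q ∈ U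
  · rcases p with _ | p
    · simp [pairRight_apply, boxIndicator_apply, hq]
    · simp [pairRight_apply, boxIndicator_apply, hq, Finset.sum_ite_eq]
  · simp [pairRight_apply, boxIndicator_apply, hq]

theorem left_diagonalSum_self (T U : Finset I) :
    (pairModule G I).left (diagonalSum G T) (boxIndicator (U.map .some) (T.map .some)) =
      boxIndicator (U.map .some) (T.map .some) +
        (T.card : ℂ) • boxIndicator (U.map .some) {none} := by
  classical
  ext ⟨p, q⟩
  rw [left_diagonalSum, BoundedFun.add_apply, BoundedFun.smul_apply]
  rcases p with _ | p
  · simp [pairLeft_apply, boxIndicator_apply]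
  by_cases hp : p ∈ U
  · rcases q with _ | q
    · simp [pairLeft_apply, boxIndicator_apply, hp]
    · simp [pairLeft_apply, boxIndicator_apply, hp, Finset.sum_ite_eq]
  · simp [pairLeft_apply, boxIndicator_apply, hp]

/-- The term with factor `T.card` would sit at `(∞, ∞)`, which the action discards. This missing
term is what keeps the averages along rows from being balanced away. -/
theorem right_diagonalSum_self_none (T : Finset I) :
    (pairModule G I).right (diagonalSum G T) (boxIndicator (T.map .some) {none}) =
      boxIndicator (T.map .some) {none} := by
  classical
  ext ⟨p, q⟩
  rw [right_diagonalSum]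
  rcases q with _ | q
  · rcases p with _ | p
    · simp [pairRight_apply, boxIndicator_apply]
    · simp [pairRight_apply, boxIndicator_apply]
  · simp [pairRight_apply, boxIndicator_apply]

theorem pairCocycle_diagonalSum (T : Finset I) (F : BoundedFun (PointedPair.{u} I)) :
    lift pairCocycle 2 norm_pairCocycle_le (diagonalSum G T) F =
      ∑ i ∈ T, (F ⟨(some i, none)⟩ - F ⟨(none, some i)⟩) := by
  rw [diagonalSum, map_sum, sum_apply]
  simp only [lift_delta, one_smul, pairCocycle_entry_apply]

theorem pairCocycle_boxIndicator (T U V : Finset I) :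
    lift pairCocycle 2 norm_pairCocycle_le (diagonalSum G T)
      (boxIndicator (U.map .some) (V.map .some)) = 0 := by
  rw [pairCocycle_diagonalSum]
  simp [boxIndicator_apply]

theorem pairCocycle_boxIndicator_none_of_disjoint {T U : Finset I} (h : Disjoint T U) :
    lift pairCocycle 2 norm_pairCocycle_le (diagonalSum G T)
      (boxIndicator (U.map .some) {none}) = 0 := by
  rw [pairCocycle_diagonalSum]
  refine Finset.sum_eq_zero fun i hi => ?_
  have : i ∉ U := Finset.disjoint_left.1 h hi
  simp [boxIndicator_apply, this]

theorem pairCocycle_boxIndicator_none (T : Finset I) :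
    lift pairCocycle 2 norm_pairCocycle_le (diagonalSum G T)
      (boxIndicator (T.map .some) {none}) = T.card := by
  rw [pairCocycle_diagonalSum]
  simp +contextual [boxIndicator_apply]

/-- The block system of the indicator functions of products of the blocks `T n`. -/
def pairBlockSystem {T : ℕ → Finset I} (hT : ∀ n, (T n).card = 4 ^ n)
    (hdisj : ∀ m n, m ≠ n → Disjoint (T m) (T n)) :
    BlockSystem (SemigroupAlgebraL1 (BrandtSemigroup G I))
      (BoundedFun (PointedPair.{u} I)) (pairModule G I).left (pairModule G I).right
      (lift pairCocycle 2 norm_pairCocycle_le) where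
  z n := diagonalSum G (T n)
  box m n := boxIndicator ((T m).map .some) ((T n).map .some)
  row m := boxIndicator ((T m).map .some) {none}
  col n := boxIndicator {none} ((T n).map .some)
  norm_z n := (norm_diagonalSum_le (T n)).trans (by rw [hT]; norm_cast)
  norm_row _ := norm_boxIndicator_le _ _
  norm_col _ := norm_boxIndicator_le _ _
  norm_box _ _ := norm_boxIndicator_le _ _
  right_box m n := by
    have h := right_diagonalSum_self (G := G) (T m) (T n)
    rw [hT] at h
    exact_mod_cast h
  right_box_of_ne k m _ h := right_diagonalSum_of_disjoint (hdisj k m h) _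
  left_box m n := by
    have h := left_diagonalSum_self (G := G) (T n) (T m)
    rw [hT] at h
    exact_mod_cast h
  left_box_of_ne k _ n h := left_diagonalSum_of_disjoint (hdisj k n h) _
  right_row m := right_diagonalSum_self_none (T m)
  right_row_of_ne k m h := right_diagonalSum_of_disjoint (hdisj k m h) _
  left_row k _ := left_diagonalSum_none (T k) _
  deriv_box k m n := pairCocycle_boxIndicator (T k) (T m) (T n)
  deriv_row := by
    rw [pairCocycle_boxIndicator_none, hT]
    norm_num
  deriv_row_of_ne k m h := pairCocycle_boxIndicator_none_of_disjoint (hdisj k m h)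

theorem finite_of_isApproximatelyAmenable
    (H : IsApproximatelyAmenable (SemigroupAlgebraL1 (BrandtSemigroup G I))) : Finite I := by
  by_contra hI
  rw [not_finite_iff_infinite] at hI
  obtain ⟨T, hT, hdisj⟩ := exists_disjoint_blocks I
  exact (pairBlockSystem (G := G) hT hdisj).not_almost_inner fun F hF =>
    exists_almost_inner_pairCocycle H F hF (by norm_num)

end BrandtSemigroup

end

theorem mainTheorem1 (G : Type*) [Group G] (I : Type*) [Nonempty I] :
    List.TFAE
      [IsStrongPseudoAmenable (SemigroupAlgebraL1 (BrandtSemigroup G I)),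
        IsAmenableGroup G ∧ Finite I,
        IsApproximatelyAmenable (SemigroupAlgebraL1 (BrandtSemigroup G I))] := by
  tfae_have 1 → 2 := BrandtSemigroup.finite_and_isAmenableGroup_of_isStrongPseudoAmenable
  tfae_have 2 → 1 := by
    rintro ⟨hG, hI⟩
    have := Fintype.ofFinite I
    obtain ⟨m, hm⟩ := BrandtSemigroup.exists_isVirtualDiagonal (I := I) hG
    exact hm.isStrongPseudoAmenable
  tfae_have 2 → 3 := by
    rintro ⟨hG, hI⟩
    have := Fintype.ofFinite I
    obtain ⟨m, hm⟩ := BrandtSemigroup.exists_isVirtualDiagonal (I := I) hG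
    exact hm.isApproximatelyAmenable
  tfae_have 3 → 2 := fun h =>
    ⟨BrandtSemigroup.isAmenableGroup_of_isApproximatelyAmenable h,
      BrandtSemigroup.finite_of_isApproximatelyAmenable h⟩
  tfae_finish
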